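/- Let $R$ be a commutative Noetherian ring, let $p$ be a prime number and let $C_p=\langle\sigma\rangle$ be a cyclic group of order $p$ with a chosen generator $\sigma$. For a commutative ring $S$, let $\mathrm{perm}(C_p,S)$ be the category of finitely generated permutation $SC_p$-modules (modules with a finite $S$-basis permuted by $C_p$), and let $\mathcal K(C_p,S)=\mathbf K_b(\mathrm{perm}(C_p,S))^{\natural}$ be the idempotent completion of its bounded homotopy category, with the tensor product $\otimes_S$ (diagonal $C_p$-action) and with unit $S$ concentrated in degree $0$. Let $u_{p,S}\in\mathcal K(C_p,S)$ be the complex $$0\to SC_p\xrightarrow{\ \epsilon\ } S\to 0 \quad (p=2),\qquad\qquad 0\to SC_p\xrightarrow{\ \sigma-1\ } SC_p\xrightarrow{\ \epsilon\ } S\to 0\quad (p>2),$$ where $\epsilon$ is the augmentation and $S$ sits in degree $0$ (homological grading). Then $u_{p,R}$ is $\otimes$-invertible in $\mathcal K(C_p,R)$, that is, there is $y\in\mathcal K(C_p,R)$ with $u_{p,R}\otimes y\simeq R$. Moreover, for every $\mathfrak p\in\operatorname{Spec}(R)$, with residue field $k(\mathfrak p)$, the base change functor $\iota_{\mathfrak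 p}^{*}=k(\mathfrak p)\otimes_R-\colon\mathcal K(C_p,R)\to\mathcal K(C_p,k(\mathfrak p))$ satisfies $$\iota_{\mathfrak p}^{*}(u_{p,R})\simeq u_{p,k(\mathfrak p)}\quad\text{in }\mathcal K(C_p,k(\mathfrak p)).$$ -/

import Mathlib

open CategoryTheory CategoryTheory.Limits CategoryTheory.MonoidalCategory TensorProduct
open scoped ZeroObject
universe u

namespace PermutationModules

noncomputable section

/-- Koszul signs `(-1)^i` for the tensor product of `ℤ`-indexed chain complexes
(homological grading). -/
instance tensorSignsDownInt : (ComplexShape.down ℤ).TensorSigns where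
  ε' := MonoidHom.mk' (fun i : ℤ => Int.negOnePow i) Int.negOnePow_add
  rel_add p q r (hpq : q + 1 = p) := by change q + r + 1 = p + r; lia
  add_rel p q r (hpq : q + 1 = p) := by change r + q + 1 = r + p; lia
  ε'_succ := by
    rintro p q (rfl : q + 1 = p)
    change Int.negOnePow q = - Int.negOnePow (q + 1)
    rw [Int.negOnePow_succ, neg_neg]

section Karoubi

open Idempotents

variable {C : Type*} [Category C] [MonoidalCategory C]

lemma idem_pentagon (P Q S T : C) (p : P ⟶ P) (q : Q ⟶ Q) (s : S ⟶ S) (t : T ⟶ T)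
   (hp : p ≫ p = p) (hq : q ≫ q = q) (hs : s ≫ s = s) (ht : t ≫ t = t) :
   ((((p ⊗ₘ q) ⊗ₘ s) ≫ (α_ P Q S).hom) ⊗ₘ t) ≫ (((p ⊗ₘ (q ⊗ₘ s)) ⊗ₘ t) ≫ (α_ P (Q ⊗ S) T).hom) ≫
     (p ⊗ₘ (((q ⊗ₘ s) ⊗ₘ t) ≫ (α_ Q S T).hom)) =
   ((((p ⊗ₘ q) ⊗ₘ s) ⊗ₘ t) ≫ (α_ (P ⊗ Q) S T).hom) ≫ ((p ⊗ₘ q) ⊗ₘ (s ⊗ₘ t)) ≫ (α_ P Q (S ⊗ T)).hom := by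
  have e1 : ((((p ⊗ₘ q) ⊗ₘ s) ≫ (α_ P Q S).hom) ⊗ₘ t) =
      (((p ⊗ₘ q) ⊗ₘ s) ⊗ₘ t) ≫ (α_ P Q S).hom ▷ T := by
    rw [← tensorHom_id, tensorHom_comp_tensorHom, Category.comp_id]
  have e2 : (α_ P Q S).hom ▷ T ≫ ((p ⊗ₘ (q ⊗ₘ s)) ⊗ₘ t) =
      (((p ⊗ₘ q) ⊗ₘ s) ⊗ₘ t) ≫ (α_ P Q S).hom ▷ T := by
    rw [← tensorHom_id, tensorHom_comp_tensorHom, tensorHom_comp_tensorHom, Category.comp_id,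
      Category.id_comp, associator_naturality]
  have e3 : (p ⊗ₘ (((q ⊗ₘ s) ⊗ₘ t) ≫ (α_ Q S T).hom)) =
      (p ⊗ₘ ((q ⊗ₘ s) ⊗ₘ t)) ≫ P ◁ (α_ Q S T).hom := by
    rw [← id_tensorHom, tensorHom_comp_tensorHom, Category.comp_id]
  have e4 := associator_naturality p (q ⊗ₘ s) t
  have e5 := associator_naturality (p ⊗ₘ q) s t
  have e6 : (((p ⊗ₘ q) ⊗ₘ s) ⊗ₘ t) ≫ (((p ⊗ₘ q) ⊗ₘ s) ⊗ₘ t) = (((p ⊗ₘ q) ⊗ₘ s) ⊗ₘ t) := by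
    simp only [tensorHom_comp_tensorHom, hp, hq, hs, ht]
  rw [e1, e3]
  simp only [Category.assoc]
  rw [← reassoc_of% e4, ← reassoc_of% e5, reassoc_of% e2, reassoc_of% e2]
  simp only [reassoc_of% e6]
  rw [pentagon]

lemma idem_triangle (P Q : C) (p : P ⟶ P) (q : Q ⟶ Q)  (hp : p ≫ p = p) (hq : q ≫ q = q) :
  (((p ⊗ₘ 𝟙 (𝟙_ C)) ⊗ₘ q) ≫ (α_ P (𝟙_ C) Q).hom) ≫ (p ⊗ₘ ((𝟙 (𝟙_ C) ⊗ₘ q) ≫ (λ_ Q).hom)) =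
   ((p ⊗ₘ 𝟙 (𝟙_ C)) ≫ (ρ_ P).hom) ⊗ₘ q := by
  have e1 : (((p ⊗ₘ 𝟙 (𝟙_ C)) ≫ (ρ_ P).hom) ⊗ₘ q) =
      ((p ⊗ₘ 𝟙 (𝟙_ C)) ⊗ₘ q) ≫ (ρ_ P).hom ▷ Q := by
    rw [← tensorHom_id, tensorHom_comp_tensorHom, Category.comp_id]
  have e3 : (p ⊗ₘ ((𝟙 (𝟙_ C) ⊗ₘ q) ≫ (λ_ Q).hom)) =
      (p ⊗ₘ (𝟙 (𝟙_ C) ⊗ₘ q)) ≫ P ◁ (λ_ Q).hom := by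
    rw [← id_tensorHom, tensorHom_comp_tensorHom, Category.comp_id]
  have e4 := associator_naturality p (𝟙 (𝟙_ C)) q
  have e6 : ((p ⊗ₘ 𝟙 (𝟙_ C)) ⊗ₘ q) ≫ ((p ⊗ₘ 𝟙 (𝟙_ C)) ⊗ₘ q) = ((p ⊗ₘ 𝟙 (𝟙_ C)) ⊗ₘ q) := by
    simp only [tensorHom_comp_tensorHom, hp, hq, Category.comp_id]
  rw [e1, e3]
  simp only [Category.assoc]
  rw [← reassoc_of% e4, reassoc_of% e6, triangle]

/-- The tensor product on the idempotent completion: `(X, p) ⊗ (Y, q) = (X ⊗ Y, p ⊗ q)`. -/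
instance karoubiMonoidalStruct : MonoidalCategoryStruct (Karoubi C) where
  tensorObj P Q := ⟨P.X ⊗ Q.X, P.p ⊗ₘ Q.p, by simp⟩
  tensorHom f g := ⟨f.f ⊗ₘ g.f, by simp⟩
  whiskerLeft P _ _ g := ⟨P.p ⊗ₘ g.f, by simp⟩
  whiskerRight f Q := ⟨f.f ⊗ₘ Q.p, by simp⟩
  tensorUnit := ⟨𝟙_ C, 𝟙 _, by simp⟩
  associator P Q S :=
    { hom := ⟨((P.p ⊗ₘ Q.p) ⊗ₘ S.p) ≫ (α_ P.X Q.X S.X).hom, by simp⟩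
      inv := ⟨(P.p ⊗ₘ (Q.p ⊗ₘ S.p)) ≫ (α_ P.X Q.X S.X).inv, by simp⟩
      hom_inv_id := by ext; simp
      inv_hom_id := by ext; simp }
  leftUnitor P :=
    { hom := ⟨(𝟙 _ ⊗ₘ P.p) ≫ (λ_ P.X).hom, by simp⟩
      inv := ⟨P.p ≫ (λ_ P.X).inv, by simp⟩
      hom_inv_id := by ext; simp
      inv_hom_id := by ext; simp }
  rightUnitor P :=
    { hom := ⟨(P.p ⊗ₘ 𝟙 _) ≫ (ρ_ P.X).hom, by simp⟩
      inv := ⟨P.p ≫ (ρ_ P.X).inv, by simp⟩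
      hom_inv_id := by ext; simp
      inv_hom_id := by ext; simp }

@[simp] lemma karoubi_tensor_X (P Q : Karoubi C) : (P ⊗ Q).X = P.X ⊗ Q.X := rfl
@[simp] lemma karoubi_tensor_p (P Q : Karoubi C) : (P ⊗ Q).p = P.p ⊗ₘ Q.p := rfl
@[simp] lemma karoubi_unit_X : (𝟙_ (Karoubi C)).X = 𝟙_ C := rfl
@[simp] lemma karoubi_unit_p : (𝟙_ (Karoubi C)).p = 𝟙 _ := rfl
@[simp] lemma karoubi_tensorHom_f {P P' Q Q' : Karoubi C} (f : P ⟶ P') (g : Q ⟶ Q') :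
    (f ⊗ₘ g).f = f.f ⊗ₘ g.f := rfl
@[simp] lemma karoubi_whiskerLeft_f (P : Karoubi C) {Q Q' : Karoubi C} (g : Q ⟶ Q') :
    (P ◁ g).f = P.p ⊗ₘ g.f := rfl
@[simp] lemma karoubi_whiskerRight_f {P P' : Karoubi C} (f : P ⟶ P') (Q : Karoubi C) :
    (f ▷ Q).f = f.f ⊗ₘ Q.p := rfl
@[simp] lemma karoubi_associator_f (P Q S : Karoubi C) :
    (α_ P Q S).hom.f = ((P.p ⊗ₘ Q.p) ⊗ₘ S.p) ≫ (α_ P.X Q.X S.X).hom := rfl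
@[simp] lemma karoubi_leftUnitor_f (P : Karoubi C) :
    (λ_ P).hom.f = (𝟙 _ ⊗ₘ P.p) ≫ (λ_ P.X).hom := rfl
@[simp] lemma karoubi_rightUnitor_f (P : Karoubi C) :
    (ρ_ P).hom.f = (P.p ⊗ₘ 𝟙 _) ≫ (ρ_ P.X).hom := rfl

instance karoubiMonoidal : MonoidalCategory (Karoubi C) where
  tensorHom_def f g := by ext; simp
  id_tensorHom_id P Q := by ext; simp
  tensorHom_comp_tensorHom f g h k := by ext; simp
  whiskerLeft_id P Q := by ext; simp
  id_whiskerRight P Q := by ext; simp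
  associator_naturality f g h := by ext; simp
  leftUnitor_naturality f := by ext; simp
  rightUnitor_naturality f := by ext; simp
  pentagon P Q S T := by
    ext; exact idem_pentagon _ _ _ _ _ _ _ _ P.idem Q.idem S.idem T.idem
  triangle P Q := by ext; exact idem_triangle _ _ _ _ P.idem Q.idem

end Karoubi

section Quotient

variable {C : Type*} [Category C] [MonoidalCategory C]

/-- A relation on morphisms that is compatible with the tensor product. -/
def TensorCompatible (r : HomRel C) : Prop :=
  ∀ {K K' L L' : C} {f f' : K ⟶ K'} {g g' : L ⟶ L'}, r f f' → r g g' →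
    r (f ⊗ₘ g) (f' ⊗ₘ g')

variable (r : HomRel C)

/-- The tensor product of two classes of morphisms. -/
def quotientTensorHom {K K' L L' : CategoryTheory.Quotient r} (f : K ⟶ K') (g : L ⟶ L') :
    (Quotient.functor r).obj (K.as ⊗ L.as) ⟶ (Quotient.functor r).obj (K'.as ⊗ L'.as) :=
  (Quotient.functor r).map (Quot.out f ⊗ₘ Quot.out g)

variable [Congruence r]

lemma quotientTensorHom_map (hr : TensorCompatible r) {K K' L L' : C} (f : K ⟶ K') (g : L ⟶ L') :
    quotientTensorHom r ((Quotient.functor r).map f) ((Quotient.functor r).map g) =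
      (Quotient.functor r).map (f ⊗ₘ g) :=
  CategoryTheory.Quotient.sound _ (hr
    ((Quotient.functor_map_eq_iff r _ _).1 (Quot.out_eq _))
    ((Quotient.functor_map_eq_iff r _ _).1 (Quot.out_eq _)))

lemma quotientTensorHom_id_left (hr : TensorCompatible r) (K : C) {L L' : C} (g : L ⟶ L') :
    quotientTensorHom r (𝟙 ((Quotient.functor r).obj K)) ((Quotient.functor r).map g) =
      (Quotient.functor r).map (K ◁ g) := by
  rw [← id_tensorHom, ← quotientTensorHom_map r hr, CategoryTheory.Functor.map_id]

lemma quotientTensorHom_id_right (hr : TensorCompatible r) {L L' : C} (g : L ⟶ L') (K : C) :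
    quotientTensorHom r ((Quotient.functor r).map g) (𝟙 ((Quotient.functor r).obj K)) =
      (Quotient.functor r).map (g ▷ K) := by
  rw [← tensorHom_id, ← quotientTensorHom_map r hr, CategoryTheory.Functor.map_id]

/-- The tensor product on a quotient category: it is the given one on objects, and the induced
one on classes of morphisms. -/
@[reducible] def quotientMonoidalStruct : MonoidalCategoryStruct (CategoryTheory.Quotient r) where
  tensorObj K L := (Quotient.functor r).obj (K.as ⊗ L.as)
  tensorHom f g := quotientTensorHom r f g
  whiskerLeft K _ _ g := quotientTensorHom r (𝟙 K) g
  whiskerRight f L := quotientTensorHom r f (𝟙 L)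
  tensorUnit := (Quotient.functor r).obj (𝟙_ C)
  associator K L M := (Quotient.functor r).mapIso (α_ K.as L.as M.as)
  leftUnitor K := (Quotient.functor r).mapIso (λ_ K.as)
  rightUnitor K := (Quotient.functor r).mapIso (ρ_ K.as)

/-- The monoidal structure on the quotient of a monoidal category by a compatible congruence. -/
@[reducible] def quotientMonoidal (hr : TensorCompatible r) : MonoidalCategory (CategoryTheory.Quotient r) where
  __ := quotientMonoidalStruct r
  tensorHom_def := by
    rintro ⟨K⟩ ⟨K'⟩ ⟨L⟩ ⟨L'⟩ f g
    obtain ⟨f, rfl⟩ := (Quotient.functor r).map_surjective f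
    obtain ⟨g, rfl⟩ := (Quotient.functor r).map_surjective g
    have := (Quotient.functor r).congr_map (tensorHom_def f g)
    rw [Functor.map_comp, ← quotientTensorHom_map r hr, ← quotientTensorHom_id_left r hr,
      ← quotientTensorHom_id_right r hr] at this
    exact this
  id_tensorHom_id := by
    rintro ⟨K⟩ ⟨L⟩
    have := (Quotient.functor r).congr_map (id_tensorHom_id K L)
    rw [← quotientTensorHom_map r hr] at this
    exact this
  tensorHom_comp_tensorHom := by
    rintro ⟨K⟩ ⟨K'⟩ ⟨K''⟩ ⟨L⟩ ⟨L'⟩ ⟨L''⟩ f g h k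
    obtain ⟨f, rfl⟩ := (Quotient.functor r).map_surjective f
    obtain ⟨g, rfl⟩ := (Quotient.functor r).map_surjective g
    obtain ⟨h, rfl⟩ := (Quotient.functor r).map_surjective h
    obtain ⟨k, rfl⟩ := (Quotient.functor r).map_surjective k
    have := (Quotient.functor r).congr_map (tensorHom_comp_tensorHom f g h k)
    rw [Functor.map_comp, ← quotientTensorHom_map r hr, ← quotientTensorHom_map r hr,
      ← quotientTensorHom_map r hr, Functor.map_comp, Functor.map_comp] at this
    exact this
  whiskerLeft_id := by
    rintro ⟨K⟩ ⟨L⟩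
    have := (Quotient.functor r).congr_map (id_tensorHom_id K L)
    rw [← quotientTensorHom_map r hr] at this
    exact this
  id_whiskerRight := by
    rintro ⟨K⟩ ⟨L⟩
    have := (Quotient.functor r).congr_map (id_tensorHom_id K L)
    rw [← quotientTensorHom_map r hr] at this
    exact this
  associator_naturality := by
    rintro ⟨K⟩ ⟨L⟩ ⟨M⟩ ⟨K'⟩ ⟨L'⟩ ⟨M'⟩ f g h
    obtain ⟨f, rfl⟩ := (Quotient.functor r).map_surjective f
    obtain ⟨g, rfl⟩ := (Quotient.functor r).map_surjective g
    obtain ⟨h, rfl⟩ := (Quotient.functor r).map_surjective h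
    have := (Quotient.functor r).congr_map (associator_naturality f g h)
    rw [Functor.map_comp, Functor.map_comp, ← quotientTensorHom_map r hr,
      ← quotientTensorHom_map r hr, ← quotientTensorHom_map r hr,
      ← quotientTensorHom_map r hr] at this
    exact this
  leftUnitor_naturality := by
    rintro ⟨K⟩ ⟨L⟩ f
    obtain ⟨f, rfl⟩ := (Quotient.functor r).map_surjective f
    have := (Quotient.functor r).congr_map (leftUnitor_naturality f)
    rw [Functor.map_comp, Functor.map_comp, ← quotientTensorHom_id_left r hr] at this
    exact this
  rightUnitor_naturality := by
    rintro ⟨K⟩ ⟨L⟩ f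
    obtain ⟨f, rfl⟩ := (Quotient.functor r).map_surjective f
    have := (Quotient.functor r).congr_map (rightUnitor_naturality f)
    rw [Functor.map_comp, Functor.map_comp, ← quotientTensorHom_id_right r hr] at this
    exact this
  pentagon := by
    rintro ⟨K⟩ ⟨L⟩ ⟨M⟩ ⟨N⟩
    have := (Quotient.functor r).congr_map (pentagon K L M N)
    rw [Functor.map_comp, Functor.map_comp, Functor.map_comp, ← quotientTensorHom_id_left r hr,
      ← quotientTensorHom_id_right r hr] at this
    exact this
  triangle := by
    rintro ⟨K⟩ ⟨L⟩
    have := (Quotient.functor r).congr_map (triangle K L)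
    rw [Functor.map_comp, ← quotientTensorHom_id_left r hr,
      ← quotientTensorHom_id_right r hr] at this
    exact this

end Quotient

section Complexes

variable (R : Type u) [CommRing R] (G : Type) [Group G]

instance hasColimitsOfSize : HasColimitsOfSize.{0, 0} (Rep.{u} R G) :=
  hasColimitsOfSizeShrink.{0, 0, u, u} _

/-- Chain complexes (homological grading, indexed by `ℤ`) of `RG`-modules. -/
abbrev Ch := HomologicalComplex (Rep.{u} R G) (ComplexShape.down ℤ)

/-- The homotopy category of chain complexes of `RG`-modules. -/
abbrev Ho := HomotopyCategory (Rep.{u} R G) (ComplexShape.down ℤ)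

lemma tensorCompatible_homotopic :
    TensorCompatible (homotopic (Rep.{u} R G) (ComplexShape.down ℤ)) := by
  rintro K K' L L' f f' g g' ⟨hf⟩ ⟨hg⟩
  exact ⟨(HomologicalComplex.mapBifunctorMapHomotopy₁ hf g (curriedTensor _) (.down ℤ)).trans
    (HomologicalComplex.mapBifunctorMapHomotopy₂ f' hg (curriedTensor _) (.down ℤ))⟩

/-- The tensor product over `R` with diagonal `G`-action on the homotopy category. -/
instance hoMonoidal : MonoidalCategory (Ho R G) :=
  quotientMonoidal _ (tensorCompatible_homotopic R G)

end Complexes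

section Permutation

variable {R : Type u} [CommRing R] {G : Type} [Group G]

/-- A finitely generated permutation `RG`-module: an `RG`-module with a finite `R`-basis that is
permuted by `G`. -/
def IsPerm (V : Rep.{u} R G) : Prop :=
  ∃ (X : Type) (_ : Finite X) (_ : MulAction G X) (b : Module.Basis X R V.V),
    ∀ (g : G) (x : X), V.ρ g (b x) = b (g • x)

/-- A bounded complex of finitely generated permutation modules. -/
structure IsBoundedPerm (K : Ch R G) : Prop where
  isPerm (i : ℤ) : IsPerm (K.X i)
  bounded : ∃ a b : ℤ, ∀ i, i < a ∨ b < i → IsZero (K.X i)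

/-- The trivial action of `G` on a set. -/
@[reducible] def trivialAction (G : Type) [Group G] (X : Type) : MulAction G X where
  smul _ x := x
  one_smul _ := rfl
  mul_smul _ _ _ := rfl

lemma isPerm_unit : IsPerm (𝟙_ (Rep.{u} R G)) :=
  ⟨Unit, inferInstance, trivialAction G Unit, Module.Basis.singleton Unit R, fun _ _ => rfl⟩

lemma isPerm_zero {V : Rep.{u} R G} (hV : IsZero V) : IsPerm V := by
  have : Subsingleton V.V := (Rep.isZero_iff R G V).1 hV
  exact ⟨Empty, inferInstance, trivialAction G Empty, Module.Basis.empty _, fun _ x => x.elim⟩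

lemma isPerm_ofMulAction (X : Type) [Finite X] [MulAction G X] :
    IsPerm (Rep.ofMulAction R G X : Rep.{u} R G) :=
  ⟨X, inferInstance, inferInstance, ⟨MonoidAlgebra.coeffLinearEquiv R⟩, fun g x => by
    change Representation.ofMulAction R G X g (MonoidAlgebra.single x 1) =
      MonoidAlgebra.single (g • x) 1
    simp⟩

lemma isPerm_of_iso {V W : Rep.{u} R G} (e : V ≅ W) (hV : IsPerm V) : IsPerm W := by
  obtain ⟨X, hX, hXG, b, hb⟩ := hV
  let e' : V.V ≃ₗ[R] W.V := LinearEquiv.ofLinearMap e.hom.hom.toLinearMap e.inv.hom.toLinearMap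
    (LinearMap.ext fun w => congr($(e.inv_hom_id).hom w)) (LinearMap.ext fun v => congr($(e.hom_inv_id).hom v))
  refine ⟨X, hX, hXG, b.map e', fun g x => ?_⟩
  rw [Module.Basis.map_apply, Module.Basis.map_apply, ← hb]
  exact (Rep.hom_comm_apply e.hom g (b x)).symm

lemma isPerm_tensor {V W : Rep.{u} R G} (hV : IsPerm V) (hW : IsPerm W) : IsPerm (V ⊗ W) := by
  obtain ⟨X, _, _, b, hb⟩ := hV
  obtain ⟨Y, _, _, c, hc⟩ := hW
  refine ⟨X × Y, inferInstance, inferInstance, b.tensorProduct c, ?_⟩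
  rintro g ⟨x, y⟩
  change (V.ρ.tprod W.ρ) g _ = _
  simp [hb, hc]

/-- A coproduct of permutation modules with only finitely many nonzero terms. -/
lemma isPerm_coproduct {J : Type} [DecidableEq J] (f : J → Rep.{u} R G) (hf : ∀ j, IsPerm (f j))
    (S : Finset J) (hS : ∀ j, j ∉ S → IsZero (f j)) (c : Cofan f) (hc : IsColimit c) :
    IsPerm c.pt := by
  choose X hX hXG b hb using hf
  let π (j : J) : c.pt ⟶ f j := Cofan.IsColimit.desc hc
    (fun i => if h : i = j then eqToHom (by rw [h]) else 0)
  have hπ (i j : J) : c.inj i ≫ π j = if h : i = j then eqToHom (by rw [h]) else 0 :=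
    Cofan.IsColimit.fac _ _ _
  have hπ_self (j : J) : c.inj j ≫ π j = 𝟙 _ := by simp [hπ]
  have hπ_ne {i j : J} (h : i ≠ j) : c.inj i ≫ π j = 0 := by simp [hπ, h]
  have hsum : ∑ j ∈ S, π j ≫ c.inj j = 𝟙 c.pt := by
    refine Cofan.IsColimit.hom_ext hc _ _ fun i => ?_
    rw [Preadditive.comp_sum, Category.comp_id]
    by_cases hi : i ∈ S
    · rw [Finset.sum_eq_single i (fun j _ hj => by
        rw [← Category.assoc, hπ_ne hj.symm, zero_comp]) (fun h => absurd hi h),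
        ← Category.assoc, hπ_self, Category.id_comp]
    · exact (hS i hi).eq_of_src _ _
  have hπι (i j : J) (v : f i) : (π j).hom ((c.inj i).hom v) =
      if h : i = j then h ▸ v else 0 := by
    have := congr($(hπ i j).hom v)
    by_cases h : i = j
    · subst h
      simpa using this
    · simpa [h] using this
  let A : c.pt.V →ₗ[R] ((s : S) → (f s).V) := LinearMap.pi (fun s => (π s).hom.toLinearMap)
  let B : ((s : S) → (f s).V) →ₗ[R] c.pt.V :=
    ∑ s : S, (c.inj s.1).hom.toLinearMap ∘ₗ LinearMap.proj s
  have hBA : B ∘ₗ A = LinearMap.id := by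
    ext v
    have := congr($(hsum).hom v)
    rw [Rep.sum_hom] at this
    simp only [Representation.IntertwiningMap.sum_apply, Rep.hom_comp] at this
    simp only [A, B]
    simp
    rw [Finset.sum_attach S (fun j => (c.inj j).hom ((π j).hom v))]
    simpa using this
  have hAB : A ∘ₗ B = LinearMap.id := by
    refine LinearMap.pi_ext fun s v => funext fun t => ?_
    simp [A, B, hπι]
  let e : c.pt.V ≃ₗ[R] ((s : S) → (f s).V) := LinearEquiv.ofLinearMap A B hAB hBA
  refine ⟨Σ s : S, X s, inferInstance,
    { smul := fun g x => ⟨x.1, g • x.2⟩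
      one_smul := fun x => Sigma.ext rfl (heq_of_eq (one_smul G x.2))
      mul_smul := fun g h x => Sigma.ext rfl (heq_of_eq (mul_smul g h x.2)) },
    (Pi.basis (fun s : S => b s)).map e.symm, ?_⟩
  have he (s : S) (v : f s) : e.symm (Pi.single s v) = (c.inj s.1).hom v := by
    change B _ = _
    simp only [B]
    simp
    rw [Finset.sum_eq_single s (fun t _ h => by simp [Pi.single_eq_of_ne h]) (by simp)]
    simp
  rintro g ⟨s, x⟩
  change _ = ((Pi.basis (fun s : S => b s)).map e.symm) ⟨s, g • x⟩
  simp only [Module.Basis.map_apply, Pi.basis_apply, he]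
  rw [← hb, Rep.hom_comm_apply]

lemma isBoundedPerm_tensor {K L : Ch R G} (hK : IsBoundedPerm K) (hL : IsBoundedPerm L) :
    IsBoundedPerm (K ⊗ L) := by
  classical
  obtain ⟨hK, a, b, hab⟩ := hK
  obtain ⟨hL, c, d, hcd⟩ := hL
  have hzero (i j : ℤ) (h : i < a ∨ b < i ∨ j < c ∨ d < j) : IsZero (K.X i ⊗ L.X j) := by
    have h' : (i < a ∨ b < i) ∨ (j < c ∨ d < j) := by tauto
    rcases h' with h | h
    · exact (tensorRight (L.X j)).map_isZero (hab i h)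
    · exact (tensorLeft (K.X i)).map_isZero (hcd j h)
  let F : GradedObject (ℤ × ℤ) (Rep.{u} R G) := fun x => K.X x.1 ⊗ L.X x.2
  let p : ℤ × ℤ → ℤ := fun x => x.1 + x.2
  have hX (n : ℤ) : (K ⊗ L).X n = (F.cofanMapObj p n).pt := rfl
  refine ⟨fun n => ?_, a + c, b + d, fun n hn => ?_⟩
  · rw [hX]
    have hfin : {x : p ⁻¹' {n} | x.1 ∈ Set.Icc a b ×ˢ Set.Icc c d}.Finite :=
      ((Set.finite_Icc a b).prod (Set.finite_Icc c d)).preimage Subtype.val_injective.injOn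
    refine isPerm_coproduct _ (fun x => isPerm_tensor (hK _) (hL _)) hfin.toFinset
      (fun x hx => hzero _ _ ?_) _ (F.isColimitCofanMapObj p n)
    by_contra! h
    simp only [Set.Finite.mem_toFinset, Set.mem_ofPred_eq, Set.mem_prod, Set.mem_Icc] at hx
    tauto
  · rw [hX, IsZero.iff_id_eq_zero]
    refine Cofan.IsColimit.hom_ext (F.isColimitCofanMapObj p n) _ _ fun x => ?_
    refine (hzero x.1.1 x.1.2 ?_).eq_of_src _ _
    have hx : x.1.1 + x.1.2 = n := x.2
    lia

end Permutation

section SmallDerivedCategory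

variable (R : Type u) [CommRing R] (G : Type) [Group G]

/-- The full subcategory `K_b(perm(G,R))` of the homotopy category: its objects are the bounded
complexes of finitely generated permutation modules. -/
def boundedPerm : ObjectProperty (Ho R G) := fun K => IsBoundedPerm K.as

lemma isBoundedPerm_unit : IsBoundedPerm (𝟙_ (Ch R G)) where
  isPerm i := by
    by_cases hi : i = 0
    · subst hi
      exact isPerm_of_iso
        (HomologicalComplex.singleObjXSelf (ComplexShape.down ℤ) 0 (𝟙_ (Rep.{u} R G))).symm
        isPerm_unit
    · exact isPerm_zero (HomologicalComplex.isZero_single_obj_X _ _ _ _ hi)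
  bounded := ⟨0, 0, fun i hi => HomologicalComplex.isZero_single_obj_X _ _ _ _ (by lia)⟩

instance boundedPerm_isMonoidal : (boundedPerm R G).IsMonoidal where
  prop_unit := isBoundedPerm_unit R G
  prop_tensor _ _ hK hL := isBoundedPerm_tensor hK hL

/-- The bounded homotopy category of finitely generated permutation modules. -/
abbrev Kb := (boundedPerm R G).FullSubcategory

/-- The small derived category of permutation modules `𝒦(G,R) = K_b(perm(G,R))^♮`. Its tensor
product is `⊗_R` with diagonal `G`-action and its unit is `R` in degree `0`. -/
abbrev SmallPermCat := Idempotents.Karoubi (Kb R G)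

variable {R G}

/-- An object of `𝒦(G,R)` given by a bounded complex of finitely generated permutation modules. -/
abbrev SmallPermCat.of (K : Ch R G) (hK : IsBoundedPerm K) : SmallPermCat R G :=
  (Idempotents.toKaroubi (Kb R G)).obj ⟨(HomotopyCategory.quotient _ _).obj K, hK⟩

/-- `x` is `⊗`-invertible if `x ⊗ y` is isomorphic to the unit for some `y`. -/
def IsTensorInvertible {C : Type*} [Category C] [MonoidalCategory C] (x : C) : Prop :=
  ∃ y : C, Nonempty (x ⊗ y ≅ 𝟙_ C)

end SmallDerivedCategory

section BaseChange

variable (R S : Type u) [CommRing R] [CommRing S] [Algebra R S] (G : Type) [Group G]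

/-- Base change `V ↦ S ⊗_R V` of representations. -/
def baseChangeRep : Rep.{u} R G ⥤ Rep.{u} S G where
  obj V := Rep.of (X := S ⊗[R] V.V)
    { toFun := fun g => (V.ρ g).baseChange S
      map_one' := by simp [Module.End.one_eq_id]
      map_mul' := fun g h => by simp [Module.End.mul_eq_comp, LinearMap.baseChange_comp] }
  map f := Rep.ofHom
    { f.hom.toLinearMap.baseChange S with
      isIntertwining' := fun g => by
        change _ ∘ₗ (LinearMap.baseChange S _) = (LinearMap.baseChange S _) ∘ₗ _
        rw [← LinearMap.baseChange_comp, ← LinearMap.baseChange_comp, f.hom.isIntertwining'] }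
  map_id V := by
    refine Rep.hom_ext (Representation.IntertwiningMap.ext ?_)
    exact (LinearMap.baseChange_id (R := R) (A := S) (M := V.V))
  map_comp {U V W} f g := by
    refine Rep.hom_ext (Representation.IntertwiningMap.ext ?_)
    exact (LinearMap.baseChange_comp (A := S) f.hom.toLinearMap g.hom.toLinearMap)

instance baseChangeRep_additive : (baseChangeRep R S G).Additive where
  map_add {V W f g} := by
    refine Rep.hom_ext (Representation.IntertwiningMap.ext ?_)
    exact (LinearMap.baseChange_add (A := S) f.hom.toLinearMap g.hom.toLinearMap)

variable {R G} in
lemma isPerm_baseChange {V : Rep.{u} R G} (hV : IsPerm V) : IsPerm ((baseChangeRep R S G).obj V) := by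
  obtain ⟨X, hX, hXG, b, hb⟩ := hV
  refine ⟨X, hX, hXG, b.baseChange S, fun g x => ?_⟩
  change (V.ρ g).baseChange S (b.baseChange S x) = b.baseChange S (g • x)
  simp [hb]

/-- Base change on bounded complexes of permutation modules up to homotopy. -/
def baseChangeKb : Kb R G ⥤ Kb S G :=
  (boundedPerm S G).lift
    ((boundedPerm R G).ι ⋙ (baseChangeRep R S G).mapHomotopyCategory (ComplexShape.down ℤ))
    (fun K => by
      obtain ⟨h, a, b, hab⟩ := K.property
      exact ⟨fun i => isPerm_baseChange S (h i), a, b,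
        fun i hi => (baseChangeRep R S G).map_isZero (hab i hi)⟩)

/-- The base change functor `𝒦(G,R) ⥤ 𝒦(G,S)`. -/
def baseChange : SmallPermCat R G ⥤ SmallPermCat S G :=
  (Idempotents.functorExtension₂ _ _).obj (baseChangeKb R S G)

end BaseChange

section ThreeTerm
variable {C : Type*} [Category C] [Preadditive C] [HasZeroObject C] {X₂ X₁ X₀ : C}

/-- The graded object with `X₂, X₁, X₀` in degrees `2, 1, 0` and zero elsewhere. -/
def threeTermX (X₂ X₁ X₀ : C) : ℤ → C
  | .ofNat 0 => X₀
  | .ofNat 1 => X₁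
  | .ofNat 2 => X₂
  | .ofNat (_ + 3) => 0
  | .negSucc _ => 0

/-- The maps `f` from degree `2` to degree `1`, and `g` from degree `1` to degree `0`. -/
def threeTermD (f : X₂ ⟶ X₁) (g : X₁ ⟶ X₀) :
    (n : ℤ) → (threeTermX X₂ X₁ X₀ (n + 1) ⟶ threeTermX X₂ X₁ X₀ n)
  | .ofNat 0 => g
  | .ofNat 1 => f
  | .ofNat (_ + 2) => 0
  | .negSucc _ => 0

/-- The chain complex `0 → X₂ → X₁ → X₀ → 0` with `X₀` in degree `0`. -/
def threeTerm (f : X₂ ⟶ X₁) (g : X₁ ⟶ X₀) (h : f ≫ g = 0) :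
    HomologicalComplex C (ComplexShape.down ℤ) :=
  ChainComplex.of (threeTermX X₂ X₁ X₀) (threeTermD f g) fun n =>
    match n with
    | .ofNat 0 => h
    | .ofNat (_ + 1) => zero_comp
    | .negSucc _ => comp_zero

lemma threeTerm_d_two_one (f : X₂ ⟶ X₁) (g : X₁ ⟶ X₀) (h : f ≫ g = 0) :
    (threeTerm f g h).d 2 1 = f :=
  ChainComplex.of_d (threeTermX X₂ X₁ X₀) (threeTermD f g) 1

lemma threeTerm_d_one_zero (f : X₂ ⟶ X₁) (g : X₁ ⟶ X₀) (h : f ≫ g = 0) :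
    (threeTerm f g h).d 1 0 = g :=
  ChainComplex.of_d (threeTermX X₂ X₁ X₀) (threeTermD f g) 0

end ThreeTerm

section TruncatedResolution

variable (R : Type u) [CommRing R] {G : Type} [CommGroup G] (σ : G)

/-- The augmentation `ε : RG → R`, `g ↦ 1`. -/
def augmentation (G : Type) [CommGroup G] : (Rep.leftRegular R G : Rep.{u} R G) ⟶ 𝟙_ (Rep.{u} R G) :=
  (Rep.leftRegularHomEquiv (𝟙_ (Rep.{u} R G))).symm (1 : R)

/-- Multiplication by `σ - 1` on `RG`. -/
def sigmaSubOne : (Rep.leftRegular R G : Rep.{u} R G) ⟶ Rep.leftRegular R G :=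
  Rep.applyAsHom (Rep.leftRegular R G) σ - 𝟙 _

lemma augmentation_single (g : G) :
    (augmentation R G).hom (MonoidAlgebra.single g (1 : R)) = (1 : R) :=
  Rep.leftRegularHomEquiv_symm_single (A := 𝟙_ (Rep.{u} R G)) (1 : R) g

lemma sigmaSubOne_single (g : G) :
    (sigmaSubOne R σ).hom (MonoidAlgebra.single g (1 : R)) =
      (MonoidAlgebra.single (σ * g) (1 : R) - MonoidAlgebra.single g (1 : R) : MonoidAlgebra R G) := by
  rw [sigmaSubOne, Rep.sub_hom]
  change Representation.ofMulAction R G G σ (MonoidAlgebra.single g (1 : R)) -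
    (MonoidAlgebra.single g (1 : R)) = _
  simp

lemma sigmaSubOne_augmentation : sigmaSubOne R σ ≫ augmentation R G = 0 := by
  apply (Rep.leftRegularHomEquiv (𝟙_ (Rep.{u} R G))).injective
  rw [map_zero]
  change (augmentation R G).hom ((sigmaSubOne R σ).hom (MonoidAlgebra.single 1 1)) = 0
  rw [sigmaSubOne_single]
  refine (map_sub (augmentation R G).hom.toLinearMap _ _).trans ?_
  exact (congrArg₂ (· - ·) (augmentation_single R _) (augmentation_single R _)).trans (sub_self _)

/-- The complex `u_{p,R}` of `RC_p`-modules, where `C_p = ⟨σ⟩` is cyclic of prime order `p`: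
it is `0 → RC_p → R → 0` for `p = 2` and `0 → RC_p → RC_p → R → 0` for `p > 2`, with maps
`σ - 1` and `ε`, and with `R` in degree `0`. -/
def uComplex (p : ℕ) : Ch R G :=
  if p = 2 then threeTerm (0 : (0 : Rep.{u} R G) ⟶ Rep.leftRegular R G) (augmentation R G) zero_comp
  else threeTerm (sigmaSubOne R σ) (augmentation R G) (sigmaSubOne_augmentation R σ)

variable {R} in
lemma isBoundedPerm_threeTerm {X₂ X₁ X₀ : Rep.{u} R G} (f : X₂ ⟶ X₁) (g : X₁ ⟶ X₀) (h : f ≫ g = 0)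
    (h₂ : IsPerm X₂) (h₁ : IsPerm X₁) (h₀ : IsPerm X₀) : IsBoundedPerm (threeTerm f g h) where
  isPerm
    | .ofNat 0 => h₀
    | .ofNat 1 => h₁
    | .ofNat 2 => h₂
    | .ofNat (_ + 3) => isPerm_zero (isZero_zero _)
    | .negSucc _ => isPerm_zero (isZero_zero _)
  bounded := ⟨0, 2, fun i hi =>
    match i, hi with
    | .ofNat 0, hi => absurd hi (by simp)
    | .ofNat 1, hi => absurd hi (by simp)
    | .ofNat 2, hi => absurd hi (by simp)
    | .ofNat (_ + 3), _ => isZero_zero _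
    | .negSucc _, _ => isZero_zero _⟩

lemma isBoundedPerm_uComplex [Finite G] (p : ℕ) : IsBoundedPerm (uComplex R σ p) := by
  have hG : IsPerm (Rep.leftRegular R G : Rep.{u} R G) := isPerm_ofMulAction G
  unfold uComplex
  split_ifs
  · exact isBoundedPerm_threeTerm _ _ _ (isPerm_zero (isZero_zero _)) hG isPerm_unit
  · exact isBoundedPerm_threeTerm _ _ _ hG hG isPerm_unit

/-- `u_{p,R}` as an object of `𝒦(C_p,R)`. -/
def uObj [Finite G] (p : ℕ) : SmallPermCat R G :=
  SmallPermCat.of (uComplex R σ p) (isBoundedPerm_uComplex R σ p)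

end TruncatedResolution
end
end PermutationModules

/-! The inverse of `u` is its dual, up to isomorphism `0 → R → RG → RG → 0` with maps the norm
inclusion and `σ - 1` for `p > 2`, and `0 → R → RG → 0` for `p = 2`. Without the group action, `u`
has homology only in its top degree, free of rank one: the multiples of the norm element `N = ∑ g`
for `p > 2`, the kernel of `ε` for `p = 2`. Since `RG ⊗ -` is induced from the trivial group, `RG ⊗
u` contracts equivariantly onto one copy of `RG` in that degree. For `p > 2`, filtering `u ⊗ dual`
by the degree of the dual therefore leaves `RG, RG, R` in degrees `2, 1, 0` and `RG, RG` in degrees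
`1, 0`. The regular terms cancel in pairs and `R` in degree `0` survives. For `p = 2` a single pair
cancels.

The proof writes this cancellation down as an equivariant `H` of degree `+1` with `d H + H d = 1 -
(projection, then inclusion)`, verified on pairs of group elements in each bidegree;
`homotopyEquivSingle` turns such data into a homotopy equivalence. For `p > 2` the key ingredient is
`intervalSum`, the sum `I(g, h)` of the group elements met on the way from `g` to `h` by powers of
`σ`. It satisfies `(σ - 1) I(g, h) = h - g` (`sigmaSubOneₗ_intervalSum`) and is additive in its
endpoints except for a copy of `N` on wrapping around (`intervalSum_mul_right`,
`intervalSum_mul_left`). The term `cornerValue` absorbs these copies of `N`. The results are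
`homotopyEquiv_of_odd` and `homotopyEquiv_of_two`.

Base change is formal: `σ - 1` and `ε` have the same integral coefficients on group elements over
every ring, so the base changes of the modules and maps are the corresponding ones over the new
ring. -/

namespace PermutationModules

noncomputable section

/-! ### Contracting a complex onto an object in degree `0`. -/

section SingleRetract

variable {C : Type*} [Category C] [Preadditive C] [HasZeroObject C]

/-- A contraction of a complex onto an object placed in degree `0`. -/
def homotopyEquivSingle (T : HomologicalComplex C (ComplexShape.down ℤ)) {A : C}
    (f : A ⟶ T.X 0) (hf : f ≫ T.d 0 (-1) = 0) (g : T.X 0 ⟶ A) (hg : T.d 1 0 ≫ g = 0)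
    (hfg : f ≫ g = 𝟙 A) (H : ∀ n m : ℤ, n + 1 = m → (T.X n ⟶ T.X m))
    (h₀ : T.d 0 (-1) ≫ H (-1) 0 rfl + H 0 1 rfl ≫ T.d 1 0 + g ≫ f = 𝟙 _)
    (h : ∀ n : ℤ, n ≠ 0 →
      T.d n (n - 1) ≫ H (n - 1) n (by lia) + H n (n + 1) rfl ≫ T.d (n + 1) n = 𝟙 _) :
    HomotopyEquiv ((HomologicalComplex.single C (ComplexShape.down ℤ) 0).obj A) T where
  hom := HomologicalComplex.mkHomFromSingle f (by
    rintro k hk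
    obtain rfl : k = -1 := by change k + 1 = 0 at hk; lia
    exact hf)
  inv := HomologicalComplex.mkHomToSingle g (by
    rintro k hk
    obtain rfl : k = 1 := by change 0 + 1 = k at hk; lia
    exact hg)
  homotopyHomInvId := Homotopy.ofEq (by
    apply HomologicalComplex.from_single_hom_ext
    simp [reassoc_of% hfg])
  -- The identities `h₀` and `h` express the identity as `d H + H d` plus the retraction, which is a
  -- homotopy from the identity; the required direction is the opposite one.
  homotopyInvHomId := Homotopy.symm
    { hom := fun i j => if hij : i + 1 = j then H i j hij else 0
      zero := fun i j hij => dif_neg hij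
      comm := fun n => by
        rw [dNext_eq _ (show (ComplexShape.down ℤ).Rel n (n - 1) from sub_add_cancel n 1),
          prevD_eq _ (show (ComplexShape.down ℤ).Rel (n + 1) n from rfl),
          dif_pos (sub_add_cancel n 1), dif_pos rfl]
        by_cases hn : n = 0
        · subst hn
          simpa using h₀.symm
        -- Off degree `0` the retraction factors through a zero object, so only `d H + H d` remains.
        · have : (HomologicalComplex.mkHomToSingle (c := ComplexShape.down ℤ) g (by
              rintro k hk
              obtain rfl : k = 1 := by change 0 + 1 = k at hk; lia
              exact hg)).f n = 0 :=
            (HomologicalComplex.isZero_single_obj_X _ _ _ _ hn).eq_of_tgt _ _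
          rw [HomologicalComplex.comp_f, this, zero_comp, add_zero]
          exact (h n hn).symm }

end SingleRetract

/-! ### Pure tensors in a tensor product of complexes and the Koszul differential. -/

section TensorElements

variable {R : Type u} [CommRing R] {G : Type} [Group G] (K L : Ch R G)

/-- The pure tensor `x ⊗ y`, as an element of the degree `n` part of `K ⊗ L`. -/
def tmk {i j n : ℤ} (h : i + j = n) (x : (K.X i).V) (y : (L.X j).V) :
    (HomologicalComplex.X (K ⊗ L) n).V :=
  (HomologicalComplex.ιTensorObj K L i j n h).hom (x ⊗ₜ[R] y)

variable {K L}

lemma tmk_zero_left {i j n : ℤ} (h : i + j = n) (y : (L.X j).V) : tmk K L h 0 y = 0 := by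
  simp [tmk]

lemma tmk_zero_right {i j n : ℤ} (h : i + j = n) (x : (K.X i).V) : tmk K L h x 0 = 0 := by
  simp [tmk]

/-- `tmk` as a bilinear map. -/
def tmkₗ {i j n : ℤ} (h : i + j = n) :
    (K.X i).V →ₗ[R] (L.X j).V →ₗ[R] (HomologicalComplex.X (K ⊗ L) n).V :=
  (TensorProduct.mk R _ _).compr₂ (HomologicalComplex.ιTensorObj K L i j n h).hom.toLinearMap

lemma ρ_tmk {i j n : ℤ} (h : i + j = n) (x : (K.X i).V) (y : (L.X j).V) (g : G) :
    (HomologicalComplex.X (K ⊗ L) n).ρ g (tmk K L h x y) =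
      tmk K L h ((K.X i).ρ g x) ((L.X j).ρ g y) :=
  (Rep.hom_comm_apply (HomologicalComplex.ιTensorObj K L i j n h) g (x ⊗ₜ[R] y)).symm

/-- The Leibniz rule for the total differential. All degrees are tied by equations rather than
written as sums, so that no transport between degrees is needed later. -/
lemma d_tmk {i j n i' j' n' : ℤ} (h : i + j = n) (hi : i' + 1 = i) (hj : j' + 1 = j)
    (h₁ : i' + j = n') (h₂ : i + j' = n') (x : (K.X i).V) (y : (L.X j).V) :
    (HomologicalComplex.d (K ⊗ L) n n').hom (tmk K L h x y) =
      tmk K L h₁ ((K.d i i').hom x) y + i.negOnePow • tmk K L h₂ x ((L.d j j').hom y) := by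
  have e : HomologicalComplex.ιTensorObj K L i j n h ≫ HomologicalComplex.d (K ⊗ L) n n' =
      (K.d i i' ▷ L.X j) ≫ HomologicalComplex.ιTensorObj K L i' j n' h₁ +
      i.negOnePow • (K.X i ◁ L.d j j') ≫ HomologicalComplex.ιTensorObj K L i j' n' h₂ := by
    change _ ≫ HomologicalComplex.d (HomologicalComplex.mapBifunctor K L (curriedTensor _) _) n n' = _
    rw [HomologicalComplex.mapBifunctor.d_eq, Preadditive.comp_add,
      HomologicalComplex.mapBifunctor.ι_D₁, HomologicalComplex.mapBifunctor.ι_D₂,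
      HomologicalComplex.mapBifunctor.d₁_eq K L _ _ (show (ComplexShape.down ℤ).Rel i i' from hi) _ _ h₁,
      HomologicalComplex.mapBifunctor.d₂_eq K L _ _ _ (show (ComplexShape.down ℤ).Rel j j' from hj) _ h₂]
    -- The horizontal sign is `1`; the vertical one is `i.negOnePow` by the choice of
    -- `tensorSignsDownInt`.
    congr 1
    exact one_smul _ _
  have := congr($(e).hom (x ⊗ₜ[R] y))
  rw [Rep.add_hom] at this
  exact this

lemma d_tmk_of_left {i j n i' j' n' : ℤ} (h : i + j = n) (hi : i' + 1 = i) (hj : j' + 1 = j)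
    (h₂ : i + j' = n') (hK : K.d i i' = 0) (x : (K.X i).V) (y : (L.X j).V) :
    (HomologicalComplex.d (K ⊗ L) n n').hom (tmk K L h x y) =
      i.negOnePow • tmk K L h₂ x ((L.d j j').hom y) := by
  rw [d_tmk h hi hj (by lia) h₂, hK]
  change tmk K L _ 0 y + _ = _
  rw [tmk_zero_left, zero_add]

lemma d_tmk_of_right {i j n i' j' n' : ℤ} (h : i + j = n) (hi : i' + 1 = i) (hj : j' + 1 = j)
    (h₁ : i' + j = n') (hL : L.d j j' = 0) (x : (K.X i).V) (y : (L.X j).V) :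
    (HomologicalComplex.d (K ⊗ L) n n').hom (tmk K L h x y) =
      tmk K L h₁ ((K.d i i').hom x) y := by
  rw [d_tmk h hi hj h₁ (by lia), hL]
  change _ + _ • tmk K L _ x 0 = _
  rw [tmk_zero_right, smul_zero, add_zero]

lemma d_tmk_of_left_of_right {i j n i' j' n' : ℤ} (h : i + j = n) (hi : i' + 1 = i) (hj : j' + 1 = j)
    (h' : n' + 1 = n) (hK : K.d i i' = 0) (hL : L.d j j' = 0) (x : (K.X i).V) (y : (L.X j).V) :
    (HomologicalComplex.d (K ⊗ L) n n').hom (tmk K L h x y) = 0 := by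
  rw [d_tmk_of_right h hi hj (by lia) hL, hK]
  exact tmk_zero_left _ _

lemma tensor_hom_ext {n : ℤ} {W : Rep.{u} R G} {f g : HomologicalComplex.X (K ⊗ L) n ⟶ W}
    (h : ∀ (i j : ℤ) (h : i + j = n) (x : (K.X i).V) (y : (L.X j).V),
      f.hom (tmk K L h x y) = g.hom (tmk K L h x y)) : f = g := by
  refine HomologicalComplex.mapBifunctor.hom_ext fun i j hij => ?_
  refine Rep.hom_ext (Representation.IntertwiningMap.ext (TensorProduct.ext' fun x y => ?_))
  exact h i j hij x y

/-- Morphisms out of `(K ⊗ L)_n`. -/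
def tensorDesc {n : ℤ} {W : Rep.{u} R G} (f : ∀ (i j : ℤ), i + j = n → (K.X i ⊗ L.X j ⟶ W)) :
    HomologicalComplex.X (K ⊗ L) n ⟶ W :=
  HomologicalComplex.mapBifunctorDesc (K₁ := K) (K₂ := L) (F := curriedTensor _)
    (c := ComplexShape.down ℤ) f

lemma tensorDesc_tmk {n : ℤ} {W : Rep.{u} R G} (f : ∀ (i j : ℤ), i + j = n → (K.X i ⊗ L.X j ⟶ W))
    {i j : ℤ} (h : i + j = n) (x : (K.X i).V) (y : (L.X j).V) :
    (tensorDesc f).hom (tmk K L h x y) = (f i j h).hom (x ⊗ₜ[R] y) := by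
  have := HomologicalComplex.ι_mapBifunctorDesc (K₁ := K) (K₂ := L) (F := curriedTensor _)
    (c := ComplexShape.down ℤ) f i j h
  exact congr($(this).hom (x ⊗ₜ[R] y))

end TensorElements

/-! ### Morphisms defined on permuted bases. -/

section PermBasis

variable {R : Type u} [CommRing R] {G : Type} [Group G]

/-- A basis of a representation that is permuted by the group. -/
structure PermBasis (V : Rep.{u} R G) (X : Type) [MulAction G X] where
  /-- the basis -/
  basis : Module.Basis X R V.V
  ρ_basis (g : G) (x : X) : V.ρ g (basis x) = basis (g • x)

namespace PermBasis

variable {V W : Rep.{u} R G} {X Y : Type} [MulAction G X] [MulAction G Y]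

/-- The morphism of representations given by an equivariant map on a permuted basis. -/
def desc (b : PermBasis V X) (φ : X → W.V) (hφ : ∀ g x, φ (g • x) = W.ρ g (φ x)) : V ⟶ W :=
  Rep.ofHom ⟨b.basis.constr ℕ φ, fun g => b.basis.ext fun x => by simp [b.ρ_basis, hφ]⟩

@[simp]
lemma desc_basis (b : PermBasis V X) (φ : X → W.V) (hφ : ∀ g x, φ (g • x) = W.ρ g (φ x)) (x : X) :
    (b.desc φ hφ).hom (b.basis x) = φ x :=
  b.basis.constr_basis ℕ φ x

/-- The tensor product of permuted bases. -/
def tensor (b : PermBasis V X) (c : PermBasis W Y) : PermBasis (V ⊗ W) (X × Y) where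
  basis := b.basis.tensorProduct c.basis
  ρ_basis := by
    rintro g ⟨x, y⟩
    change (V.ρ.tprod W.ρ) g _ = _
    simp [b.ρ_basis, c.ρ_basis]

lemma desc_tensor_tmul (b : PermBasis V X) (c : PermBasis W Y) {Z : Rep.{u} R G} (φ : X × Y → Z.V)
    (hφ : ∀ g x, φ (g • x) = Z.ρ g (φ x)) (x : X) (y : Y) :
    ((b.tensor c).desc φ hφ).hom (b.basis x ⊗ₜ[R] c.basis y) = φ (x, y) := by
  rw [← (b.tensor c).desc_basis φ hφ (x, y)]
  simp [tensor]

variable (R G) in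
/-- The basis of the unit. -/
def unit : PermBasis (𝟙_ (Rep.{u} R G)) PUnit where
  basis := Module.Basis.singleton PUnit R
  ρ_basis _ _ := rfl

variable (R G) in
/-- The group elements form a permuted basis of the regular representation. -/
def regular : PermBasis (Rep.leftRegular R G : Rep.{u} R G) G where
  basis := ⟨MonoidAlgebra.coeffLinearEquiv R⟩
  ρ_basis g x := by
    change Representation.ofMulAction R G G g (MonoidAlgebra.single x 1) =
      MonoidAlgebra.single (g • x) 1
    simp

end PermBasis

end PermBasis

/-! ### The norm element and interval sums in the group ring of a cyclic group. -/

section GroupRing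

variable (R : Type u) [CommRing R] {G : Type} [CommGroup G]

/-- The element of the group ring given by a group element. -/
def gp (g : G) : MonoidAlgebra R G := MonoidAlgebra.single g (1 : R)

/-- Left translation on the group ring. -/
abbrev translation (g : G) : MonoidAlgebra R G →ₗ[R] MonoidAlgebra R G :=
  Representation.ofMulAction R G G g

lemma translation_gp (g h : G) : translation R g (gp R h) = gp R (g * h) := by
  simp [gp]

/-- Multiplication by `σ - 1` as a linear map. -/
def sigmaSubOneₗ (σ : G) : MonoidAlgebra R G →ₗ[R] MonoidAlgebra R G :=
  (sigmaSubOne R σ).hom.toLinearMap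

lemma sigmaSubOneₗ_gp (σ g : G) : sigmaSubOneₗ R σ (gp R g) = gp R (σ * g) - gp R g :=
  sigmaSubOne_single R σ g

variable (G) in
/-- The augmentation as a linear map. -/
def augmentationₗ : MonoidAlgebra R G →ₗ[R] R := (augmentation R G).hom.toLinearMap

lemma augmentationₗ_gp (g : G) : augmentationₗ R G (gp R g) = 1 :=
  augmentation_single R g

lemma basis_regular (g : G) : (PermBasis.regular R G).basis g = gp R g := rfl

lemma unit_hom_ext {W : Rep.{u} R G} {f g : 𝟙_ (Rep.{u} R G) ⟶ W}
    (h : f.hom (1 : R) = g.hom (1 : R)) : f = g :=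
  Rep.hom_ext (Representation.IntertwiningMap.ext (LinearMap.ext_ring h))

variable (G) in
/-- The sum of all group elements. -/
def normElt [Fintype G] : MonoidAlgebra R G := ∑ g, gp R g

lemma translation_normElt [Fintype G] (g : G) : translation R g (normElt R G) = normElt R G := by
  simp only [normElt, map_sum, translation_gp]
  exact Fintype.sum_equiv (Equiv.mulLeft g) _ _ fun _ => rfl

variable (G) in
/-- The map `R → RG` with image the multiples of the sum of all group elements. -/
def coaugmentation [Fintype G] : 𝟙_ (Rep.{u} R G) ⟶ (Rep.leftRegular R G : Rep.{u} R G) :=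
  (PermBasis.unit R G).desc (fun _ => normElt R G) fun g _ => (translation_normElt R g).symm

lemma basis_unit (x : PUnit) : (PermBasis.unit R G).basis x = (1 : R) :=
  Module.Basis.singleton_apply PUnit R x

lemma coaugmentation_one [Fintype G] : (coaugmentation R G).hom (1 : R) = normElt R G := by
  have h := (PermBasis.unit R G).desc_basis (W := Rep.leftRegular R G) (fun _ => normElt R G)
    (fun g _ => (translation_normElt R g).symm) PUnit.unit
  rw [basis_unit] at h
  exact h

lemma sigmaSubOneₗ_normElt [Fintype G] (σ : G) : sigmaSubOneₗ R σ (normElt R G) = 0 := by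
  simp only [normElt, map_sum, sigmaSubOneₗ_gp, Finset.sum_sub_distrib]
  exact sub_eq_zero.2 (Fintype.sum_equiv (Equiv.mulLeft σ) _ _ fun _ => rfl)

lemma coaugmentation_sigmaSubOne [Fintype G] (σ : G) :
    coaugmentation R G ≫ sigmaSubOne R σ = 0 :=
  unit_hom_ext R (by
    change (sigmaSubOne R σ).hom ((coaugmentation R G).hom (1 : R)) = 0
    rw [coaugmentation_one]
    exact sigmaSubOneₗ_normElt R σ)

variable (σ : G)

/-- The exponent of an element with respect to a generator. -/
def exponent (g : G) : ℕ := sInf {i | σ ^ i = g}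

/-- The sum `1 + σ + ⋯ + σ^(i-1)`, for `k = σ^i`. -/
def initialSum (k : G) : MonoidAlgebra R G :=
  ∑ i ∈ Finset.range (exponent σ k), gp R (σ ^ i)

/-- The sum of the group elements from `g` to `h`, including `g` and excluding `h`. -/
def intervalSum (g h : G) : MonoidAlgebra R G :=
  translation R g (initialSum R σ (g⁻¹ * h))

lemma translation_intervalSum (k g h : G) :
    translation R k (intervalSum R σ g h) = intervalSum R σ (k * g) (k * h) := by
  have : (k * g)⁻¹ * (k * h) = g⁻¹ * h := by group
  simp only [intervalSum, initialSum, map_sum, translation_gp, mul_assoc, this]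

variable {σ}

/-- Finiteness turns integer powers into natural ones, so the set whose infimum defines `exponent`
is nonempty and the infimum is attained. -/
lemma pow_exponent [Finite G] (hσ : ∀ g : G, g ∈ Subgroup.zpowers σ) (g : G) :
    σ ^ exponent σ g = g := by
  obtain ⟨n, hn⟩ := (mem_powers_iff_mem_zpowers).2 (hσ g)
  exact Nat.sInf_mem (s := {i | σ ^ i = g}) ⟨n, hn⟩

lemma exponent_lt [Finite G] (hσ : ∀ g : G, g ∈ Subgroup.zpowers σ) (g : G) :
    exponent σ g < orderOf σ := by
  refine lt_of_le_of_lt (Nat.sInf_le ?_) (Nat.mod_lt (exponent σ g) (orderOf_pos σ))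
  change σ ^ _ = g
  rw [pow_mod_orderOf, pow_exponent hσ]

lemma exponent_pow [Finite G] (hσ : ∀ g : G, g ∈ Subgroup.zpowers σ) {i : ℕ} (hi : i < orderOf σ) :
    exponent σ (σ ^ i) = i :=
  pow_injOn_Iio_orderOf (exponent_lt hσ _) hi (pow_exponent hσ _)

lemma sum_range_orderOf [Fintype G] (hσ : ∀ g : G, g ∈ Subgroup.zpowers σ) :
    ∑ i ∈ Finset.range (orderOf σ), gp R (σ ^ i) = normElt R G :=
  Finset.sum_bij' (fun i _ => σ ^ i) (fun g _ => exponent σ g) (fun _ _ => Finset.mem_univ _)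
    (fun g _ => Finset.mem_range.2 (exponent_lt hσ g))
    (fun _ hi => exponent_pow hσ (Finset.mem_range.1 hi)) (fun g _ => pow_exponent hσ g)
    fun _ _ => rfl

/-- Multiplying by `σ` raises the exponent by one and adds one summand. When the exponent would
reach the order of `σ` it drops to `0` instead, and the completed sum, which is the norm element, is
lost. -/
lemma initialSum_mul [Fintype G] [DecidableEq G] (hσ : ∀ g : G, g ∈ Subgroup.zpowers σ) (k : G) :
    initialSum R σ (σ * k) =
      initialSum R σ k + gp R k - if σ * k = 1 then normElt R G else 0 := by
  have hk : initialSum R σ k + gp R k =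
      ∑ i ∈ Finset.range (exponent σ k + 1), gp R (σ ^ i) := by
    rw [Finset.sum_range_succ, pow_exponent hσ, initialSum]
  have hmul : σ * k = σ ^ (exponent σ k + 1) := by rw [pow_succ', pow_exponent hσ]
  rcases (Nat.succ_le_of_lt (exponent_lt hσ k)).lt_or_eq with h | h
  · have hne : σ * k ≠ 1 := by
      rw [hmul]
      exact pow_ne_one_of_lt_orderOf (Nat.succ_ne_zero _) h
    rw [if_neg hne, sub_zero, hk, initialSum, hmul, exponent_pow hσ h]
  · have h1 : σ * k = 1 := by rw [hmul, ← Nat.succ_eq_add_one, h, pow_orderOf_eq_one]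
    rw [if_pos h1, hk, ← Nat.succ_eq_add_one, h, sum_range_orderOf R hσ, sub_self, h1]
    have : exponent σ (1 : G) = 0 := Nat.sInf_eq_zero.2 (Or.inl (pow_zero σ))
    simp [initialSum, this]

lemma intervalSum_mul_right [Fintype G] [DecidableEq G] (hσ : ∀ g : G, g ∈ Subgroup.zpowers σ)
    (g h : G) :
    intervalSum R σ g (σ * h) =
      intervalSum R σ g h + gp R h - if σ * h = g then normElt R G else 0 := by
  have e : g⁻¹ * (σ * h) = σ * (g⁻¹ * h) := mul_left_comm _ _ _
  have e' : σ * (g⁻¹ * h) = 1 ↔ σ * h = g := by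
    rw [← e, inv_mul_eq_one, eq_comm]
  rw [intervalSum, e, initialSum_mul R hσ, map_sub, map_add, translation_gp, mul_inv_cancel_left]
  simp only [e', apply_ite (translation R g), translation_normElt, map_zero, intervalSum]

/-- The sum telescopes. This is what makes `intervalSum` a contracting homotopy for `σ - 1`. -/
lemma sigmaSubOneₗ_intervalSum [Finite G] (hσ : ∀ g : G, g ∈ Subgroup.zpowers σ) (g h : G) :
    sigmaSubOneₗ R σ (intervalSum R σ g h) = gp R h - gp R g := by
  have (i : ℕ) : σ * (g * σ ^ i) = g * σ ^ (i + 1) := by rw [pow_succ', mul_left_comm]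
  simp only [intervalSum, initialSum, map_sum, translation_gp, sigmaSubOneₗ_gp, this]
  rw [Finset.sum_range_sub (fun i => gp R (g * σ ^ i)), pow_exponent hσ, pow_zero,
    mul_inv_cancel_left, mul_one]

/-- Apply `σ - 1` to the interval sum in two ways: as a translation minus the identity, which moves
both endpoints, and by telescoping. Then undo the move of the right endpoint with
`intervalSum_mul_right`. -/
lemma intervalSum_mul_left [Fintype G] [DecidableEq G] (hσ : ∀ g : G, g ∈ Subgroup.zpowers σ)
    (g h : G) :
    intervalSum R σ (σ * g) h =
      intervalSum R σ g h - gp R g + if g = h then normElt R G else 0 := by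
  have h1 := intervalSum_mul_right R hσ (σ * g) h
  have h2 := sigmaSubOneₗ_intervalSum R hσ g h
  have h3 : sigmaSubOneₗ R σ (intervalSum R σ g h) =
      intervalSum R σ (σ * g) (σ * h) - intervalSum R σ g h := by
    rw [← translation_intervalSum]
    rfl
  rw [h3, h1] at h2
  simp only [mul_right_inj, eq_comm (a := h)] at h2
  rw [← sub_eq_zero] at h2 ⊢
  exact Eq.trans (by abel) h2

end GroupRing

/-! ### Three-term complexes in degrees `0, -1, -2`, the shape of the dual. -/

section CoThreeTerm
variable {C : Type*} [Category C] [Preadditive C] [HasZeroObject C] {Y₀ Y₁ Y₂ : C}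

/-- The graded object with `Y₀, Y₁, Y₂` in degrees `0, -1, -2` and zero elsewhere. -/
def coThreeTermX (Y₀ Y₁ Y₂ : C) : ℤ → C
  | .ofNat 0 => Y₀
  | .ofNat (_ + 1) => 0
  | .negSucc 0 => Y₁
  | .negSucc 1 => Y₂
  | .negSucc (_ + 2) => 0

/-- The maps `f` from degree `0` to degree `-1`, and `g` from degree `-1` to degree `-2`. -/
def coThreeTermD (f : Y₀ ⟶ Y₁) (g : Y₁ ⟶ Y₂) :
    (n : ℤ) → (coThreeTermX Y₀ Y₁ Y₂ (n + 1) ⟶ coThreeTermX Y₀ Y₁ Y₂ n)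
  | .ofNat _ => 0
  | .negSucc 0 => f
  | .negSucc 1 => g
  | .negSucc (_ + 2) => 0

/-- The chain complex `0 → Y₀ → Y₁ → Y₂ → 0` with `Y₀` in degree `0`. -/
def coThreeTerm (f : Y₀ ⟶ Y₁) (g : Y₁ ⟶ Y₂) (h : f ≫ g = 0) :
    HomologicalComplex C (ComplexShape.down ℤ) :=
  ChainComplex.of (coThreeTermX Y₀ Y₁ Y₂) (coThreeTermD f g) fun n =>
    match n with
    | .ofNat _ => comp_zero
    | .negSucc 0 => zero_comp
    | .negSucc 1 => h
    | .negSucc (_ + 2) => comp_zero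

lemma coThreeTerm_d_zero_neg_one (f : Y₀ ⟶ Y₁) (g : Y₁ ⟶ Y₂) (h : f ≫ g = 0) :
    (coThreeTerm f g h).d 0 (-1) = f :=
  ChainComplex.of_d (coThreeTermX Y₀ Y₁ Y₂) (coThreeTermD f g) (Int.negSucc 0)

lemma coThreeTerm_d_neg_one_neg_two (f : Y₀ ⟶ Y₁) (g : Y₁ ⟶ Y₂) (h : f ≫ g = 0) :
    (coThreeTerm f g h).d (-1) (-2) = g :=
  ChainComplex.of_d (coThreeTermX Y₀ Y₁ Y₂) (coThreeTermD f g) (Int.negSucc 1)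

end CoThreeTerm

/-! ### The nine bidegrees of a tensor product of two three-term complexes. -/

section Blocks

variable {R : Type u} [CommRing R] {G : Type} [Group G]

lemma isBoundedPerm_coThreeTerm {Y₀ Y₁ Y₂ : Rep.{u} R G} (f : Y₀ ⟶ Y₁) (g : Y₁ ⟶ Y₂)
    (h : f ≫ g = 0) (h₀ : IsPerm Y₀) (h₁ : IsPerm Y₁) (h₂ : IsPerm Y₂) :
    IsBoundedPerm (coThreeTerm f g h) where
  isPerm
    | .ofNat 0 => h₀
    | .ofNat (_ + 1) => isPerm_zero (isZero_zero _)
    | .negSucc 0 => h₁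
    | .negSucc 1 => h₂
    | .negSucc (_ + 2) => isPerm_zero (isZero_zero _)
  bounded := ⟨-2, 0, fun i hi =>
    match i, hi with
    | .ofNat 0, hi => absurd hi (by simp)
    | .ofNat (_ + 1), _ => isZero_zero _
    | .negSucc 0, hi => absurd hi (by simp)
    | .negSucc 1, hi => absurd hi (by simp)
    | .negSucc (_ + 2), _ => isZero_zero _⟩

/-- Two morphisms agree on the image of a bilinear map if they agree on pairs of basis vectors. -/
lemma eq_on_bilinear {V W Z Z' : Rep.{u} R G} (B : V.V →ₗ[R] W.V →ₗ[R] Z.V) {a b : Z ⟶ Z'}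
    {I J : Type*} (bV : Module.Basis I R V.V) (bW : Module.Basis J R W.V)
    (h : ∀ i j, a.hom (B (bV i) (bW j)) = b.hom (B (bV i) (bW j))) (x : V.V) (y : W.V) :
    a.hom (B x y) = b.hom (B x y) :=
  LinearMap.congr_fun₂ (f := B.compr₂ a.hom.toLinearMap) (g := B.compr₂ b.hom.toLinearMap)
    (LinearMap.ext_basis bV bW h) x y

lemma tmk_eq_zero_of_left {K L : Ch R G} {i j n : ℤ} (h : i + j = n) (hK : IsZero (K.X i))
    (x : (K.X i).V) (y : (L.X j).V) : tmk K L h x y = 0 := by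
  have := (Rep.isZero_iff R G _).1 hK
  rw [Subsingleton.elim x 0, tmk_zero_left]

lemma tmk_eq_zero_of_right {K L : Ch R G} {i j n : ℤ} (h : i + j = n) (hL : IsZero (L.X j))
    (x : (K.X i).V) (y : (L.X j).V) : tmk K L h x y = 0 := by
  have := (Rep.isZero_iff R G _).1 hL
  rw [Subsingleton.elim y 0, tmk_zero_right]

/-- The data of complexes `0 → X₂ → X₁ → X₀ → 0` and `0 → Y₀ → Y₁ → Y₂ → 0`. -/
structure ThreeTermPair (X₂ X₁ X₀ Y₀ Y₁ Y₂ : Rep.{u} R G) where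
  /-- the first differential of the first complex -/
  f : X₂ ⟶ X₁
  /-- the second differential of the first complex -/
  g : X₁ ⟶ X₀
  w : f ≫ g = 0
  /-- the first differential of the second complex -/
  f' : Y₀ ⟶ Y₁
  /-- the second differential of the second complex -/
  g' : Y₁ ⟶ Y₂
  w' : f' ≫ g' = 0

variable {X₂ X₁ X₀ Y₀ Y₁ Y₂ : Rep.{u} R G} {P : ThreeTermPair X₂ X₁ X₀ Y₀ Y₁ Y₂}

variable (P) in
/-- The complex `0 → X₂ → X₁ → X₀ → 0`. -/
abbrev ThreeTermPair.left : Ch R G := threeTerm P.f P.g P.w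

variable (P) in
/-- The complex `0 → Y₀ → Y₁ → Y₂ → 0`. -/
abbrev ThreeTermPair.right : Ch R G := coThreeTerm P.f' P.g' P.w'

variable (P) in
/-- The tensor product of `0 → X₂ → X₁ → X₀ → 0` and `0 → Y₀ → Y₁ → Y₂ → 0`. -/
abbrev tensorThree : Ch R G := P.left ⊗ P.right

variable (P) in
/-- Pure tensors in bidegree `(0, 0)`. -/
def t00 {n : ℤ} (hn : 0 + 0 = n) :
    X₀.V →ₗ[R] Y₀.V →ₗ[R] ((tensorThree P).X n).V :=
  tmkₗ (K := P.left) (L := P.right) hn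

lemma ρ_t00 {n : ℤ} (hn : 0 + 0 = n) (k : G) (x : X₀.V) (y : Y₀.V) :
    ((tensorThree P).X n).ρ k (t00 P hn x y) =
      t00 P hn (X₀.ρ k x) (Y₀.ρ k y) :=
  ρ_tmk (K := P.left) (L := P.right) hn x y k

variable (P) in
/-- Pure tensors in bidegree `(0, -1)`. -/
def t01 {n : ℤ} (hn : 0 + (-1) = n) :
    X₀.V →ₗ[R] Y₁.V →ₗ[R] ((tensorThree P).X n).V :=
  tmkₗ (K := P.left) (L := P.right) hn

variable (P) in
/-- Pure tensors in bidegree `(0, -2)`. -/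
def t02 {n : ℤ} (hn : 0 + (-2) = n) :
    X₀.V →ₗ[R] Y₂.V →ₗ[R] ((tensorThree P).X n).V :=
  tmkₗ (K := P.left) (L := P.right) hn

variable (P) in
/-- Pure tensors in bidegree `(1, 0)`. -/
def t10 {n : ℤ} (hn : 1 + 0 = n) :
    X₁.V →ₗ[R] Y₀.V →ₗ[R] ((tensorThree P).X n).V :=
  tmkₗ (K := P.left) (L := P.right) hn

lemma ρ_t10 {n : ℤ} (hn : 1 + 0 = n) (k : G) (x : X₁.V) (y : Y₀.V) :
    ((tensorThree P).X n).ρ k (t10 P hn x y) =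
      t10 P hn (X₁.ρ k x) (Y₀.ρ k y) :=
  ρ_tmk (K := P.left) (L := P.right) hn x y k

variable (P) in
/-- Pure tensors in bidegree `(1, -1)`. -/
def t11 {n : ℤ} (hn : 1 + (-1) = n) :
    X₁.V →ₗ[R] Y₁.V →ₗ[R] ((tensorThree P).X n).V :=
  tmkₗ (K := P.left) (L := P.right) hn

lemma ρ_t11 {n : ℤ} (hn : 1 + (-1) = n) (k : G) (x : X₁.V) (y : Y₁.V) :
    ((tensorThree P).X n).ρ k (t11 P hn x y) =
      t11 P hn (X₁.ρ k x) (Y₁.ρ k y) :=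
  ρ_tmk (K := P.left) (L := P.right) hn x y k

variable (P) in
/-- Pure tensors in bidegree `(1, -2)`. -/
def t12 {n : ℤ} (hn : 1 + (-2) = n) :
    X₁.V →ₗ[R] Y₂.V →ₗ[R] ((tensorThree P).X n).V :=
  tmkₗ (K := P.left) (L := P.right) hn

lemma ρ_t12 {n : ℤ} (hn : 1 + (-2) = n) (k : G) (x : X₁.V) (y : Y₂.V) :
    ((tensorThree P).X n).ρ k (t12 P hn x y) =
      t12 P hn (X₁.ρ k x) (Y₂.ρ k y) :=
  ρ_tmk (K := P.left) (L := P.right) hn x y k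

variable (P) in
/-- Pure tensors in bidegree `(2, 0)`. -/
def t20 {n : ℤ} (hn : 2 + 0 = n) :
    X₂.V →ₗ[R] Y₀.V →ₗ[R] ((tensorThree P).X n).V :=
  tmkₗ (K := P.left) (L := P.right) hn

lemma ρ_t20 {n : ℤ} (hn : 2 + 0 = n) (k : G) (x : X₂.V) (y : Y₀.V) :
    ((tensorThree P).X n).ρ k (t20 P hn x y) =
      t20 P hn (X₂.ρ k x) (Y₀.ρ k y) :=
  ρ_tmk (K := P.left) (L := P.right) hn x y k

variable (P) in
/-- Pure tensors in bidegree `(2, -1)`. -/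
def t21 {n : ℤ} (hn : 2 + (-1) = n) :
    X₂.V →ₗ[R] Y₁.V →ₗ[R] ((tensorThree P).X n).V :=
  tmkₗ (K := P.left) (L := P.right) hn

lemma ρ_t21 {n : ℤ} (hn : 2 + (-1) = n) (k : G) (x : X₂.V) (y : Y₁.V) :
    ((tensorThree P).X n).ρ k (t21 P hn x y) =
      t21 P hn (X₂.ρ k x) (Y₁.ρ k y) :=
  ρ_tmk (K := P.left) (L := P.right) hn x y k

variable (P) in
/-- Pure tensors in bidegree `(2, -2)`. -/
def t22 {n : ℤ} (hn : 2 + (-2) = n) :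
    X₂.V →ₗ[R] Y₂.V →ₗ[R] ((tensorThree P).X n).V :=
  tmkₗ (K := P.left) (L := P.right) hn

lemma ρ_t22 {n : ℤ} (hn : 2 + (-2) = n) (k : G) (x : X₂.V) (y : Y₂.V) :
    ((tensorThree P).X n).ρ k (t22 P hn x y) =
      t22 P hn (X₂.ρ k x) (Y₂.ρ k y) :=
  ρ_tmk (K := P.left) (L := P.right) hn x y k

/-- In these nine formulas the second term carries the sign `(-1)^i`, so it is negative only in
first degree `1`; terms leaving the range of either complex vanish. -/
lemma d_t00 {n m : ℤ} (hn : 0 + 0 = n) (h₂ : 0 + (-1) = m) (x : X₀.V) (y : Y₀.V) :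
    ((tensorThree P).d n m).hom (t00 P hn x y) =
      t01 P h₂ x (P.f'.hom y) := by
  have key := d_tmk_of_left (K := P.left) (L := P.right)
    (i' := -1) (j' := -1) (n' := m) hn (by lia) (by lia) h₂ ((isZero_zero _).eq_of_tgt _ _) x y
  rw [coThreeTerm_d_zero_neg_one, Int.negOnePow_even _ (by decide), one_smul] at key
  exact key

lemma d_t01 {n m : ℤ} (hn : 0 + (-1) = n) (h₂ : 0 + (-2) = m) (x : X₀.V) (y : Y₁.V) :
    ((tensorThree P).d n m).hom (t01 P hn x y) =
      t02 P h₂ x (P.g'.hom y) := by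
  have key := d_tmk_of_left (K := P.left) (L := P.right)
    (i' := -1) (j' := -2) (n' := m) hn (by lia) (by lia) h₂ ((isZero_zero _).eq_of_tgt _ _) x y
  rw [coThreeTerm_d_neg_one_neg_two, Int.negOnePow_even _ (by decide), one_smul] at key
  exact key

lemma d_t02 {n m : ℤ} (hn : 0 + (-2) = n) (hm : m + 1 = n) (x : X₀.V) (y : Y₂.V) :
    ((tensorThree P).d n m).hom (t02 P hn x y) =
      0 := by
  have key := d_tmk_of_left_of_right (K := P.left) (L := P.right)
    (i' := -1) (j' := -3) (n' := m) hn (by lia) (by lia) hm ((isZero_zero _).eq_of_tgt _ _) ((isZero_zero _).eq_of_tgt _ _) x y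
  exact key

lemma d_t10 {n m : ℤ} (hn : 1 + 0 = n) (h₁ : 0 + 0 = m) (h₂ : 1 + (-1) = m) (x : X₁.V) (y : Y₀.V) :
    ((tensorThree P).d n m).hom (t10 P hn x y) =
      t00 P h₁ (P.g.hom x) y - t11 P h₂ x (P.f'.hom y) := by
  have key := d_tmk (K := P.left) (L := P.right)
    (i' := 0) (j' := -1) (n' := m) hn (by lia) (by lia) h₁ h₂ x y
  rw [threeTerm_d_one_zero, coThreeTerm_d_zero_neg_one, Int.negOnePow_one, Units.neg_smul, one_smul, ← sub_eq_add_neg] at key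
  exact key

lemma d_t11 {n m : ℤ} (hn : 1 + (-1) = n) (h₁ : 0 + (-1) = m) (h₂ : 1 + (-2) = m) (x : X₁.V) (y : Y₁.V) :
    ((tensorThree P).d n m).hom (t11 P hn x y) =
      t01 P h₁ (P.g.hom x) y - t12 P h₂ x (P.g'.hom y) := by
  have key := d_tmk (K := P.left) (L := P.right)
    (i' := 0) (j' := -2) (n' := m) hn (by lia) (by lia) h₁ h₂ x y
  rw [threeTerm_d_one_zero, coThreeTerm_d_neg_one_neg_two, Int.negOnePow_one, Units.neg_smul, one_smul, ← sub_eq_add_neg] at key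
  exact key

lemma d_t12 {n m : ℤ} (hn : 1 + (-2) = n) (h₁ : 0 + (-2) = m) (x : X₁.V) (y : Y₂.V) :
    ((tensorThree P).d n m).hom (t12 P hn x y) =
      t02 P h₁ (P.g.hom x) y := by
  have key := d_tmk_of_right (K := P.left) (L := P.right)
    (i' := 0) (j' := -3) (n' := m) hn (by lia) (by lia) h₁ ((isZero_zero _).eq_of_tgt _ _) x y
  rw [threeTerm_d_one_zero] at key
  exact key

lemma d_t20 {n m : ℤ} (hn : 2 + 0 = n) (h₁ : 1 + 0 = m) (h₂ : 2 + (-1) = m) (x : X₂.V) (y : Y₀.V) :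
    ((tensorThree P).d n m).hom (t20 P hn x y) =
      t10 P h₁ (P.f.hom x) y + t21 P h₂ x (P.f'.hom y) := by
  have key := d_tmk (K := P.left) (L := P.right)
    (i' := 1) (j' := -1) (n' := m) hn (by lia) (by lia) h₁ h₂ x y
  rw [threeTerm_d_two_one, coThreeTerm_d_zero_neg_one, Int.negOnePow_even _ (by decide), one_smul] at key
  exact key

lemma d_t21 {n m : ℤ} (hn : 2 + (-1) = n) (h₁ : 1 + (-1) = m) (h₂ : 2 + (-2) = m) (x : X₂.V) (y : Y₁.V) :
    ((tensorThree P).d n m).hom (t21 P hn x y) =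
      t11 P h₁ (P.f.hom x) y + t22 P h₂ x (P.g'.hom y) := by
  have key := d_tmk (K := P.left) (L := P.right)
    (i' := 1) (j' := -2) (n' := m) hn (by lia) (by lia) h₁ h₂ x y
  rw [threeTerm_d_two_one, coThreeTerm_d_neg_one_neg_two, Int.negOnePow_even _ (by decide), one_smul] at key
  exact key

lemma d_t22 {n m : ℤ} (hn : 2 + (-2) = n) (h₁ : 1 + (-2) = m) (x : X₂.V) (y : Y₂.V) :
    ((tensorThree P).d n m).hom (t22 P hn x y) =
      t12 P h₁ (P.f.hom x) y := by
  have key := d_tmk_of_right (K := P.left) (L := P.right)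
    (i' := 1) (j' := -3) (n' := m) hn (by lia) (by lia) h₁ ((isZero_zero _).eq_of_tgt _ _) x y
  rw [threeTerm_d_two_one] at key
  exact key

lemma tensorThree_hom_ext {n : ℤ} {W : Rep.{u} R G}
    {a b : (tensorThree P).X n ⟶ W}
    (e00 : ∀ (hn : 0 + 0 = n) x y, a.hom (t00 P hn x y) = b.hom (t00 P hn x y))
    (e01 : ∀ (hn : 0 + (-1) = n) x y, a.hom (t01 P hn x y) = b.hom (t01 P hn x y))
    (e02 : ∀ (hn : 0 + (-2) = n) x y, a.hom (t02 P hn x y) = b.hom (t02 P hn x y))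
    (e10 : ∀ (hn : 1 + 0 = n) x y, a.hom (t10 P hn x y) = b.hom (t10 P hn x y))
    (e11 : ∀ (hn : 1 + (-1) = n) x y, a.hom (t11 P hn x y) = b.hom (t11 P hn x y))
    (e12 : ∀ (hn : 1 + (-2) = n) x y, a.hom (t12 P hn x y) = b.hom (t12 P hn x y))
    (e20 : ∀ (hn : 2 + 0 = n) x y, a.hom (t20 P hn x y) = b.hom (t20 P hn x y))
    (e21 : ∀ (hn : 2 + (-1) = n) x y, a.hom (t21 P hn x y) = b.hom (t21 P hn x y))
    (e22 : ∀ (hn : 2 + (-2) = n) x y, a.hom (t22 P hn x y) = b.hom (t22 P hn x y)) : a = b := by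
  refine tensor_hom_ext fun i j hij x y => ?_
  have hK (hi : IsZero (P.left.X i)) :
      a.hom (tmk P.left P.right hij x y) =
        b.hom (tmk P.left P.right hij x y) := by
    rw [tmk_eq_zero_of_left hij hi, map_zero, map_zero]
  have hL (hj : IsZero (P.right.X j)) :
      a.hom (tmk P.left P.right hij x y) =
        b.hom (tmk P.left P.right hij x y) := by
    rw [tmk_eq_zero_of_right hij hj, map_zero, map_zero]
  -- Splitting the integers by constructors lets the graded pieces reduce to `X₀, X₁, X₂`, `Y₀, Y₁,
  -- Y₂` or the zero object.
  match i, j, hij, x, y, hK, hL with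
  | .negSucc _, _, _, _, _, hK, _ => exact hK (isZero_zero _)
  | .ofNat (_ + 3), _, _, _, _, hK, _ => exact hK (isZero_zero _)
  | .ofNat 0, .ofNat (_ + 1), _, _, _, _, hL => exact hL (isZero_zero _)
  | .ofNat 1, .ofNat (_ + 1), _, _, _, _, hL => exact hL (isZero_zero _)
  | .ofNat 2, .ofNat (_ + 1), _, _, _, _, hL => exact hL (isZero_zero _)
  | .ofNat 0, .negSucc (_ + 2), _, _, _, _, hL => exact hL (isZero_zero _)
  | .ofNat 1, .negSucc (_ + 2), _, _, _, _, hL => exact hL (isZero_zero _)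
  | .ofNat 2, .negSucc (_ + 2), _, _, _, _, hL => exact hL (isZero_zero _)
  | .ofNat 0, .ofNat 0, hij, x, y, _, _ => exact e00 hij x y
  | .ofNat 0, .negSucc 0, hij, x, y, _, _ => exact e01 hij x y
  | .ofNat 0, .negSucc 1, hij, x, y, _, _ => exact e02 hij x y
  | .ofNat 1, .ofNat 0, hij, x, y, _, _ => exact e10 hij x y
  | .ofNat 1, .negSucc 0, hij, x, y, _, _ => exact e11 hij x y
  | .ofNat 1, .negSucc 1, hij, x, y, _, _ => exact e12 hij x y
  | .ofNat 2, .ofNat 0, hij, x, y, _, _ => exact e20 hij x y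
  | .ofNat 2, .negSucc 0, hij, x, y, _, _ => exact e21 hij x y
  | .ofNat 2, .negSucc 1, hij, x, y, _, _ => exact e22 hij x y

variable (P) in
/-- Morphisms out of a tensor product of three-term complexes, given on the nine summands. -/
def tensorThreeDesc {n : ℤ} {W : Rep.{u} R G}
    (φ00 : 0 + 0 = n → (X₀ ⊗ Y₀ ⟶ W))
    (φ01 : 0 + (-1) = n → (X₀ ⊗ Y₁ ⟶ W))
    (φ02 : 0 + (-2) = n → (X₀ ⊗ Y₂ ⟶ W))
    (φ10 : 1 + 0 = n → (X₁ ⊗ Y₀ ⟶ W))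
    (φ11 : 1 + (-1) = n → (X₁ ⊗ Y₁ ⟶ W))
    (φ12 : 1 + (-2) = n → (X₁ ⊗ Y₂ ⟶ W))
    (φ20 : 2 + 0 = n → (X₂ ⊗ Y₀ ⟶ W))
    (φ21 : 2 + (-1) = n → (X₂ ⊗ Y₁ ⟶ W))
    (φ22 : 2 + (-2) = n → (X₂ ⊗ Y₂ ⟶ W)) :
    (tensorThree P).X n ⟶ W :=
  tensorDesc (K := P.left) (L := P.right) fun i j hij =>
    match i, j, hij with
    | .ofNat 0, .ofNat 0, hij => φ00 hij
    | .ofNat 0, .negSucc 0, hij => φ01 hij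
    | .ofNat 0, .negSucc 1, hij => φ02 hij
    | .ofNat 1, .ofNat 0, hij => φ10 hij
    | .ofNat 1, .negSucc 0, hij => φ11 hij
    | .ofNat 1, .negSucc 1, hij => φ12 hij
    | .ofNat 2, .ofNat 0, hij => φ20 hij
    | .ofNat 2, .negSucc 0, hij => φ21 hij
    | .ofNat 2, .negSucc 1, hij => φ22 hij
    -- Every other summand has a zero factor, so the value is immaterial.
    | _, _, _ => 0

section
variable {n : ℤ} {W : Rep.{u} R G}
  {φ00 : 0 + 0 = n → (X₀ ⊗ Y₀ ⟶ W)}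
  {φ01 : 0 + (-1) = n → (X₀ ⊗ Y₁ ⟶ W)}
  {φ02 : 0 + (-2) = n → (X₀ ⊗ Y₂ ⟶ W)}
  {φ10 : 1 + 0 = n → (X₁ ⊗ Y₀ ⟶ W)}
  {φ11 : 1 + (-1) = n → (X₁ ⊗ Y₁ ⟶ W)}
  {φ12 : 1 + (-2) = n → (X₁ ⊗ Y₂ ⟶ W)}
  {φ20 : 2 + 0 = n → (X₂ ⊗ Y₀ ⟶ W)}
  {φ21 : 2 + (-1) = n → (X₂ ⊗ Y₁ ⟶ W)}
  {φ22 : 2 + (-2) = n → (X₂ ⊗ Y₂ ⟶ W)}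

lemma tensorThreeDesc_t00 (hn : 0 + 0 = n) (x : X₀.V) (y : Y₀.V) :
    (tensorThreeDesc P φ00 φ01 φ02 φ10 φ11 φ12 φ20 φ21 φ22).hom
      (t00 P hn x y) = (φ00 hn).hom (x ⊗ₜ[R] y) :=
  tensorDesc_tmk (K := P.left) (L := P.right) _ hn x y

lemma tensorThreeDesc_t01 (hn : 0 + (-1) = n) (x : X₀.V) (y : Y₁.V) :
    (tensorThreeDesc P φ00 φ01 φ02 φ10 φ11 φ12 φ20 φ21 φ22).hom
      (t01 P hn x y) = (φ01 hn).hom (x ⊗ₜ[R] y) :=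
  tensorDesc_tmk (K := P.left) (L := P.right) _ hn x y

lemma tensorThreeDesc_t02 (hn : 0 + (-2) = n) (x : X₀.V) (y : Y₂.V) :
    (tensorThreeDesc P φ00 φ01 φ02 φ10 φ11 φ12 φ20 φ21 φ22).hom
      (t02 P hn x y) = (φ02 hn).hom (x ⊗ₜ[R] y) :=
  tensorDesc_tmk (K := P.left) (L := P.right) _ hn x y

lemma tensorThreeDesc_t10 (hn : 1 + 0 = n) (x : X₁.V) (y : Y₀.V) :
    (tensorThreeDesc P φ00 φ01 φ02 φ10 φ11 φ12 φ20 φ21 φ22).hom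
      (t10 P hn x y) = (φ10 hn).hom (x ⊗ₜ[R] y) :=
  tensorDesc_tmk (K := P.left) (L := P.right) _ hn x y

lemma tensorThreeDesc_t11 (hn : 1 + (-1) = n) (x : X₁.V) (y : Y₁.V) :
    (tensorThreeDesc P φ00 φ01 φ02 φ10 φ11 φ12 φ20 φ21 φ22).hom
      (t11 P hn x y) = (φ11 hn).hom (x ⊗ₜ[R] y) :=
  tensorDesc_tmk (K := P.left) (L := P.right) _ hn x y

lemma tensorThreeDesc_t12 (hn : 1 + (-2) = n) (x : X₁.V) (y : Y₂.V) :
    (tensorThreeDesc P φ00 φ01 φ02 φ10 φ11 φ12 φ20 φ21 φ22).hom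
      (t12 P hn x y) = (φ12 hn).hom (x ⊗ₜ[R] y) :=
  tensorDesc_tmk (K := P.left) (L := P.right) _ hn x y

lemma tensorThreeDesc_t20 (hn : 2 + 0 = n) (x : X₂.V) (y : Y₀.V) :
    (tensorThreeDesc P φ00 φ01 φ02 φ10 φ11 φ12 φ20 φ21 φ22).hom
      (t20 P hn x y) = (φ20 hn).hom (x ⊗ₜ[R] y) :=
  tensorDesc_tmk (K := P.left) (L := P.right) _ hn x y

lemma tensorThreeDesc_t21 (hn : 2 + (-1) = n) (x : X₂.V) (y : Y₁.V) :
    (tensorThreeDesc P φ00 φ01 φ02 φ10 φ11 φ12 φ20 φ21 φ22).hom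
      (t21 P hn x y) = (φ21 hn).hom (x ⊗ₜ[R] y) :=
  tensorDesc_tmk (K := P.left) (L := P.right) _ hn x y

lemma tensorThreeDesc_t22 (hn : 2 + (-2) = n) (x : X₂.V) (y : Y₂.V) :
    (tensorThreeDesc P φ00 φ01 φ02 φ10 φ11 φ12 φ20 φ21 φ22).hom
      (t22 P hn x y) = (φ22 hn).hom (x ⊗ₜ[R] y) :=
  tensorDesc_tmk (K := P.left) (L := P.right) _ hn x y

end

end Blocks

/-! ### Equivariant maps out of `RG ⊗ RG` and `R ⊗ RG`. -/

section EquivariantMaps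

variable {R : Type u} [CommRing R] {G : Type} [CommGroup G] {W : Rep.{u} R G}

/-- Equivariant maps out of `RG ⊗ RG`, given on pairs of group elements. -/
def descRegularRegular (φ : G → G → W.V) (hφ : ∀ k g h, W.ρ k (φ g h) = φ (k * g) (k * h)) :
    (Rep.leftRegular R G : Rep.{u} R G) ⊗ (Rep.leftRegular R G : Rep.{u} R G) ⟶ W :=
  ((PermBasis.regular R G).tensor (PermBasis.regular R G)).desc (fun x => φ x.1 x.2)
    fun k x => (hφ k x.1 x.2).symm

lemma descRegularRegular_tmul (φ : G → G → W.V)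
    (hφ : ∀ k g h, W.ρ k (φ g h) = φ (k * g) (k * h)) (g h : G) :
    (descRegularRegular φ hφ).hom (gp R g ⊗ₜ[R] gp R h) = φ g h :=
  PermBasis.desc_tensor_tmul (PermBasis.regular R G) (PermBasis.regular R G)
    (fun x => φ x.1 x.2) (fun k x => (hφ k x.1 x.2).symm) g h

/-- Equivariant maps out of `R ⊗ RG`, given on group elements. -/
def descUnitRegular (φ : G → W.V) (hφ : ∀ k h, W.ρ k (φ h) = φ (k * h)) :
    𝟙_ (Rep.{u} R G) ⊗ (Rep.leftRegular R G : Rep.{u} R G) ⟶ W :=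
  ((PermBasis.unit R G).tensor (PermBasis.regular R G)).desc (fun x => φ x.2)
    fun k x => (hφ k x.2).symm

lemma descUnitRegular_tmul (φ : G → W.V) (hφ : ∀ k h, W.ρ k (φ h) = φ (k * h)) (h : G) :
    (descUnitRegular φ hφ).hom ((1 : R) ⊗ₜ[R] gp R h) = φ h := by
  have := PermBasis.desc_tensor_tmul (PermBasis.unit R G) (PermBasis.regular R G)
    (fun x => φ x.2) (fun k x => (hφ k x.2).symm) PUnit.unit h
  rw [basis_unit] at this
  exact this

/-- This pulls an augmentation `ε(x)` out of the unit factor as a scalar, so that the differential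
can be written with the generators `1 ⊗ y` only. -/
lemma eq_smul_of_unit {V Z : Rep.{u} R G} (B : (𝟙_ (Rep.{u} R G)).V →ₗ[R] V.V →ₗ[R] Z.V)
    (y : V.V) (r : R) : B r y = r • B (1 : R) y :=
  (congrArg (fun z : R => B z y) (mul_one r).symm).trans (LinearMap.map_smul₂ B r (1 : R) y)

end EquivariantMaps

/-! ### The differential of `u ⊗ dual` for `p > 2`, in terms of group ring elements. -/

section Odd

variable (R : Type u) [CommRing R] {G : Type} [CommGroup G] [Fintype G] (σ : G)

/-- The complexes `0 → RG → RG → R → 0` and `0 → R → RG → RG → 0`. -/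
abbrev oddPair : ThreeTermPair (Rep.leftRegular R G : Rep.{u} R G) (Rep.leftRegular R G)
    (𝟙_ _) (𝟙_ _) (Rep.leftRegular R G) (Rep.leftRegular R G) where
  f := sigmaSubOne R σ
  g := augmentation R G
  w := sigmaSubOne_augmentation R σ
  f' := coaugmentation R G
  g' := sigmaSubOne R σ
  w' := coaugmentation_sigmaSubOne R σ

/-- The tensor product of `0 → RG → RG → R → 0` with `0 → R → RG → RG → 0`. -/
abbrev tensorDual : Ch R G := tensorThree (oddPair R σ)

lemma oddPair_f'_one : (oddPair R σ).f'.hom (1 : R) = normElt R G := coaugmentation_one R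

/-- Elements of bidegree `(0, 0)`. -/
def e00 {n : ℤ} (hn : 0 + 0 = n) :
    ((tensorDual R σ).X n).V :=
  t00 (oddPair R σ) hn (1 : R) (1 : R)

lemma ρ_e00 {n : ℤ} (hn : 0 + 0 = n) (k : G) :
    ((tensorDual R σ).X n).ρ k (e00 R σ hn) =
      e00 R σ hn :=
  ρ_t00 (P := oddPair R σ) hn k (1 : R) (1 : R)

/-- Elements of bidegree `(0, -1)`. -/
def e01 {n : ℤ} (hn : 0 + (-1) = n) :
    MonoidAlgebra R G →ₗ[R] ((tensorDual R σ).X n).V :=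
  t01 (oddPair R σ) hn (1 : R)

/-- Elements of bidegree `(0, -2)`. -/
def e02 {n : ℤ} (hn : 0 + (-2) = n) :
    MonoidAlgebra R G →ₗ[R] ((tensorDual R σ).X n).V :=
  t02 (oddPair R σ) hn (1 : R)

/-- Elements of bidegree `(1, 0)`. -/
def e10 {n : ℤ} (hn : 1 + 0 = n) :
    MonoidAlgebra R G →ₗ[R] ((tensorDual R σ).X n).V :=
  LinearMap.flip (t10 (oddPair R σ) hn) (1 : R)

lemma ρ_e10 {n : ℤ} (hn : 1 + 0 = n) (k : G) (x : MonoidAlgebra R G) :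
    ((tensorDual R σ).X n).ρ k (e10 R σ hn x) =
      e10 R σ hn (translation R k x) :=
  ρ_t10 (P := oddPair R σ) hn k x (1 : R)

/-- Elements of bidegree `(1, -1)`. -/
def e11 {n : ℤ} (hn : 1 + (-1) = n) :
    MonoidAlgebra R G →ₗ[R] MonoidAlgebra R G →ₗ[R] ((tensorDual R σ).X n).V :=
  t11 (oddPair R σ) hn

lemma ρ_e11 {n : ℤ} (hn : 1 + (-1) = n) (k : G) (x : MonoidAlgebra R G) (y : MonoidAlgebra R G) :
    ((tensorDual R σ).X n).ρ k (e11 R σ hn x y) =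
      e11 R σ hn (translation R k x) (translation R k y) :=
  ρ_t11 (P := oddPair R σ) hn k x y

/-- Elements of bidegree `(1, -2)`. -/
def e12 {n : ℤ} (hn : 1 + (-2) = n) :
    MonoidAlgebra R G →ₗ[R] MonoidAlgebra R G →ₗ[R] ((tensorDual R σ).X n).V :=
  t12 (oddPair R σ) hn

lemma ρ_e12 {n : ℤ} (hn : 1 + (-2) = n) (k : G) (x : MonoidAlgebra R G) (y : MonoidAlgebra R G) :
    ((tensorDual R σ).X n).ρ k (e12 R σ hn x y) =
      e12 R σ hn (translation R k x) (translation R k y) :=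
  ρ_t12 (P := oddPair R σ) hn k x y

/-- Elements of bidegree `(2, 0)`. -/
def e20 {n : ℤ} (hn : 2 + 0 = n) :
    MonoidAlgebra R G →ₗ[R] ((tensorDual R σ).X n).V :=
  LinearMap.flip (t20 (oddPair R σ) hn) (1 : R)

lemma ρ_e20 {n : ℤ} (hn : 2 + 0 = n) (k : G) (x : MonoidAlgebra R G) :
    ((tensorDual R σ).X n).ρ k (e20 R σ hn x) =
      e20 R σ hn (translation R k x) :=
  ρ_t20 (P := oddPair R σ) hn k x (1 : R)

/-- Elements of bidegree `(2, -1)`. -/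
def e21 {n : ℤ} (hn : 2 + (-1) = n) :
    MonoidAlgebra R G →ₗ[R] MonoidAlgebra R G →ₗ[R] ((tensorDual R σ).X n).V :=
  t21 (oddPair R σ) hn

lemma ρ_e21 {n : ℤ} (hn : 2 + (-1) = n) (k : G) (x : MonoidAlgebra R G) (y : MonoidAlgebra R G) :
    ((tensorDual R σ).X n).ρ k (e21 R σ hn x y) =
      e21 R σ hn (translation R k x) (translation R k y) :=
  ρ_t21 (P := oddPair R σ) hn k x y

/-- Elements of bidegree `(2, -2)`. -/
def e22 {n : ℤ} (hn : 2 + (-2) = n) :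
    MonoidAlgebra R G →ₗ[R] MonoidAlgebra R G →ₗ[R] ((tensorDual R σ).X n).V :=
  t22 (oddPair R σ) hn

lemma ρ_e22 {n : ℤ} (hn : 2 + (-2) = n) (k : G) (x : MonoidAlgebra R G) (y : MonoidAlgebra R G) :
    ((tensorDual R σ).X n).ρ k (e22 R σ hn x y) =
      e22 R σ hn (translation R k x) (translation R k y) :=
  ρ_t22 (P := oddPair R σ) hn k x y

lemma d_e00 {n m : ℤ} (hn : 0 + 0 = n) (h₂ : 0 + (-1) = m) :
    ((tensorDual R σ).d n m).hom (e00 R σ hn) =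
      e01 R σ h₂ (normElt R G) := by
  have key := d_t00 (P := oddPair R σ) hn h₂ (1 : R) (1 : R)
  rw [oddPair_f'_one] at key
  exact key

lemma d_e01 {n m : ℤ} (hn : 0 + (-1) = n) (h₂ : 0 + (-2) = m) (y : MonoidAlgebra R G) :
    ((tensorDual R σ).d n m).hom (e01 R σ hn y) =
      e02 R σ h₂ (sigmaSubOneₗ R σ y) := by
  exact d_t01 (P := oddPair R σ) hn h₂ (1 : R) y

lemma d_e02 {n m : ℤ} (hn : 0 + (-2) = n) (hm : m + 1 = n) (y : MonoidAlgebra R G) :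
    ((tensorDual R σ).d n m).hom (e02 R σ hn y) =
      0 := by
  exact d_t02 (P := oddPair R σ) hn hm (1 : R) y

lemma d_e10 {n m : ℤ} (hn : 1 + 0 = n) (h₁ : 0 + 0 = m) (h₂ : 1 + (-1) = m) (x : MonoidAlgebra R G) :
    ((tensorDual R σ).d n m).hom (e10 R σ hn x) =
      augmentationₗ R G x • e00 R σ h₁ - e11 R σ h₂ x (normElt R G) := by
  have key := d_t10 (P := oddPair R σ) hn h₁ h₂ x (1 : R)
  rw [oddPair_f'_one] at key
  have e := eq_smul_of_unit (t00 (oddPair R σ) h₁) (1 : R) (augmentationₗ R G x)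
  exact key.trans (congrArg (· - _) e)

lemma d_e11 {n m : ℤ} (hn : 1 + (-1) = n) (h₁ : 0 + (-1) = m) (h₂ : 1 + (-2) = m) (x : MonoidAlgebra R G) (y : MonoidAlgebra R G) :
    ((tensorDual R σ).d n m).hom (e11 R σ hn x y) =
      augmentationₗ R G x • e01 R σ h₁ y - e12 R σ h₂ x (sigmaSubOneₗ R σ y) := by
  have key := d_t11 (P := oddPair R σ) hn h₁ h₂ x y
  have e := eq_smul_of_unit (t01 (oddPair R σ) h₁) y (augmentationₗ R G x)
  exact key.trans (congrArg (· - _) e)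

lemma d_e12 {n m : ℤ} (hn : 1 + (-2) = n) (h₁ : 0 + (-2) = m) (x : MonoidAlgebra R G) (y : MonoidAlgebra R G) :
    ((tensorDual R σ).d n m).hom (e12 R σ hn x y) =
      augmentationₗ R G x • e02 R σ h₁ y := by
  have key := d_t12 (P := oddPair R σ) hn h₁ x y
  have e := eq_smul_of_unit (t02 (oddPair R σ) h₁) y (augmentationₗ R G x)
  exact key.trans e

lemma d_e20 {n m : ℤ} (hn : 2 + 0 = n) (h₁ : 1 + 0 = m) (h₂ : 2 + (-1) = m) (x : MonoidAlgebra R G) :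
    ((tensorDual R σ).d n m).hom (e20 R σ hn x) =
      e10 R σ h₁ (sigmaSubOneₗ R σ x) + e21 R σ h₂ x (normElt R G) := by
  have key := d_t20 (P := oddPair R σ) hn h₁ h₂ x (1 : R)
  rw [oddPair_f'_one] at key
  exact key

lemma d_e21 {n m : ℤ} (hn : 2 + (-1) = n) (h₁ : 1 + (-1) = m) (h₂ : 2 + (-2) = m) (x : MonoidAlgebra R G) (y : MonoidAlgebra R G) :
    ((tensorDual R σ).d n m).hom (e21 R σ hn x y) =
      e11 R σ h₁ (sigmaSubOneₗ R σ x) y + e22 R σ h₂ x (sigmaSubOneₗ R σ y) := by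
  exact d_t21 (P := oddPair R σ) hn h₁ h₂ x y

lemma d_e22 {n m : ℤ} (hn : 2 + (-2) = n) (h₁ : 1 + (-2) = m) (x : MonoidAlgebra R G) (y : MonoidAlgebra R G) :
    ((tensorDual R σ).d n m).hom (e22 R σ hn x y) =
      e12 R σ h₁ (sigmaSubOneₗ R σ x) y := by
  exact d_t22 (P := oddPair R σ) hn h₁ x y

end Odd

/-! ### The explicit contraction, inclusion and projection for `p > 2`. -/

section OddContraction

variable (R : Type u) [CommRing R] {G : Type} [CommGroup G] [Fintype G] (σ : G)

variable {R σ} in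
-- Every identity between morphisms out of `u ⊗ dual` is thereby a finite list of identities on
-- group elements. Bidegrees outside the total degree `n` drop out because their hypothesis `hn` is
-- contradictory.
lemma tensorDual_hom_ext {n : ℤ} {W : Rep.{u} R G} {a b : (tensorDual R σ).X n ⟶ W}
    (h00 : ∀ (hn : 0 + 0 = n), a.hom (e00 R σ hn) = b.hom (e00 R σ hn))
    (h01 : ∀ (hn : 0 + (-1) = n) (y : G), a.hom (e01 R σ hn (gp R y)) = b.hom (e01 R σ hn (gp R y)))
    (h02 : ∀ (hn : 0 + (-2) = n) (y : G), a.hom (e02 R σ hn (gp R y)) = b.hom (e02 R σ hn (gp R y)))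
    (h10 : ∀ (hn : 1 + 0 = n) (x : G), a.hom (e10 R σ hn (gp R x)) = b.hom (e10 R σ hn (gp R x)))
    (h11 : ∀ (hn : 1 + (-1) = n) (x : G) (y : G), a.hom (e11 R σ hn (gp R x) (gp R y)) = b.hom (e11 R σ hn (gp R x) (gp R y)))
    (h12 : ∀ (hn : 1 + (-2) = n) (x : G) (y : G), a.hom (e12 R σ hn (gp R x) (gp R y)) = b.hom (e12 R σ hn (gp R x) (gp R y)))
    (h20 : ∀ (hn : 2 + 0 = n) (x : G), a.hom (e20 R σ hn (gp R x)) = b.hom (e20 R σ hn (gp R x)))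
    (h21 : ∀ (hn : 2 + (-1) = n) (x : G) (y : G), a.hom (e21 R σ hn (gp R x) (gp R y)) = b.hom (e21 R σ hn (gp R x) (gp R y)))
    (h22 : ∀ (hn : 2 + (-2) = n) (x : G) (y : G), a.hom (e22 R σ hn (gp R x) (gp R y)) = b.hom (e22 R σ hn (gp R x) (gp R y))) :
    a = b := by
  refine tensorThree_hom_ext (P := oddPair R σ)
    (fun hn => eq_on_bilinear (t00 (oddPair R σ) hn)
      (PermBasis.unit R G).basis (PermBasis.unit R G).basis fun x y => ?_)
    (fun hn => eq_on_bilinear (t01 (oddPair R σ) hn)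
      (PermBasis.unit R G).basis (PermBasis.regular R G).basis fun x y => ?_)
    (fun hn => eq_on_bilinear (t02 (oddPair R σ) hn)
      (PermBasis.unit R G).basis (PermBasis.regular R G).basis fun x y => ?_)
    (fun hn => eq_on_bilinear (t10 (oddPair R σ) hn)
      (PermBasis.regular R G).basis (PermBasis.unit R G).basis fun x y => ?_)
    (fun hn => eq_on_bilinear (t11 (oddPair R σ) hn)
      (PermBasis.regular R G).basis (PermBasis.regular R G).basis fun x y => ?_)
    (fun hn => eq_on_bilinear (t12 (oddPair R σ) hn)
      (PermBasis.regular R G).basis (PermBasis.regular R G).basis fun x y => ?_)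
    (fun hn => eq_on_bilinear (t20 (oddPair R σ) hn)
      (PermBasis.regular R G).basis (PermBasis.unit R G).basis fun x y => ?_)
    (fun hn => eq_on_bilinear (t21 (oddPair R σ) hn)
      (PermBasis.regular R G).basis (PermBasis.regular R G).basis fun x y => ?_)
    (fun hn => eq_on_bilinear (t22 (oddPair R σ) hn)
      (PermBasis.regular R G).basis (PermBasis.regular R G).basis fun x y => ?_)
  · rw [basis_unit]
    exact h00 hn
  · rw [basis_unit]
    exact h01 hn y
  · rw [basis_unit]
    exact h02 hn y
  · rw [basis_unit]
    exact h10 hn x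
  · exact h11 hn x y
  · exact h12 hn x y
  · rw [basis_unit]
    exact h20 hn x
  · exact h21 hn x y
  · exact h22 hn x y

/-- The value of the contraction on `1 ⊗ 1` in bidegree `(2, -2)`. -/
def cornerValue {m : ℤ} (hm : m = 1) (g : G) : ((tensorDual R σ).X m).V :=
  -- The choice is governed by `d_cornerValue`: the boundary of the sum contains `e22 N g`, and `-
  -- e10 g` cancels its term `- e11 g N` while contributing `- e00`.
  ∑ h, e21 R σ (by lia) (intervalSum R σ g h) (gp R h) - e10 R σ (by lia) (gp R g)

lemma ρ_cornerValue {m : ℤ} (hm : m = 1) (k g : G) :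
    ((tensorDual R σ).X m).ρ k (cornerValue R σ hm g) = cornerValue R σ hm (k * g) := by
  rw [cornerValue, cornerValue, map_sub, map_sum, ρ_e10, translation_gp]
  congr 1
  refine Fintype.sum_equiv (Equiv.mulLeft k) _ _ fun h => ?_
  rw [ρ_e21, translation_gp, translation_intervalSum]
  rfl

/-- The inclusion of the unit in the degree `0` part of the tensor product. -/
def unitElt {m : ℤ} (hm : m = 0) : ((tensorDual R σ).X m).V :=
  -- This is `e00` minus the contraction of its boundary `e01 N`, as the homotopy identity in
  -- bidegree `(0, 0)` forces when the contraction is zero on `e00`.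
  e00 R σ (by lia) - ∑ g, e11 R σ (by lia) (gp R g) (gp R g) +
    ∑ g, e22 R σ (by lia) (gp R g) (gp R (σ * g))

lemma ρ_unitElt {m : ℤ} (hm : m = 0) (k : G) :
    ((tensorDual R σ).X m).ρ k (unitElt R σ hm) = unitElt R σ hm := by
  simp only [unitElt, map_add, map_sub, map_sum, ρ_e00, ρ_e11, ρ_e22, translation_gp]
  congr 1
  · congr 1
    exact Fintype.sum_equiv (Equiv.mulLeft k) _ _ fun _ => rfl
  · refine Fintype.sum_equiv (Equiv.mulLeft k) _ _ fun h => ?_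
    rw [mul_left_comm]
    rfl

/-- The inclusion of the unit. -/
def unitInclusion : 𝟙_ (Rep.{u} R G) ⟶ (tensorDual R σ).X 0 :=
  (PermBasis.unit R G).desc (fun _ => unitElt R σ rfl) fun k _ => (ρ_unitElt R σ rfl k).symm

lemma unitInclusion_one : (unitInclusion R σ).hom (1 : R) = unitElt R σ rfl := by
  have h := (PermBasis.unit R G).desc_basis (W := (tensorDual R σ).X 0) (fun _ => unitElt R σ rfl)
    (fun k _ => (ρ_unitElt R σ rfl k).symm) PUnit.unit
  rw [basis_unit] at h
  exact h

variable [DecidableEq G]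

/-- The contraction of the tensor product onto its unit. -/
def contraction (n m : ℤ) (hm : n + 1 = m) : (tensorDual R σ).X n ⟶ (tensorDual R σ).X m :=
  tensorThreeDesc (oddPair R σ)
    (fun _ => 0)
    (fun hn => descUnitRegular
      (fun y => e11 R σ (by lia) (gp R y) (gp R y) - e22 R σ (by lia) (gp R y) (gp R (σ * y)))
      fun k y => by
        rw [map_sub, ρ_e11, ρ_e22, translation_gp, translation_gp, mul_left_comm])
    -- The map `y ↦ y ⊗ y` is an equivariant section of `ε ⊗ 1`. In bidegree `(0, -1)` the extra
    -- `e22` term makes this section compatible with `σ - 1` on the second factor.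
    (fun hn => descUnitRegular (fun y => e12 R σ (by lia) (gp R y) (gp R y))
      fun k y => by rw [ρ_e12, translation_gp])
    (fun _ => 0)
    -- The interval sum contracts the first factor onto the second. It wraps around exactly when `x
    -- = σ * y`, and there `cornerValue` compensates the resulting norm term.
    (fun hn => descRegularRegular
      (fun x y => (if x = σ * y then cornerValue R σ (by lia) x else 0) -
        e21 R σ (by lia) (intervalSum R σ x y) (gp R y))
      fun k x y => by
        rw [map_sub, ρ_e21, translation_gp, translation_intervalSum, apply_ite (((tensorDual R σ).X m).ρ k),
          map_zero, ρ_cornerValue, mul_left_comm σ k y]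
        simp only [mul_right_inj])
    (fun hn => descRegularRegular (fun x y => - e22 R σ (by lia) (intervalSum R σ x y) (gp R y))
      fun k x y => by rw [map_neg, ρ_e22, translation_gp, translation_intervalSum])
    (fun _ => 0)
    -- This cancels `RG` in bidegree `(2, 0)`: the boundary of `e20 x` contains `e21 x N`, in which
    -- the diagonal picks out `e21 x x` alone.
    (fun hn => descRegularRegular
      (fun x y => if x = y then e20 R σ (by lia) (gp R x) else 0)
      fun k x y => by
        rw [apply_ite (((tensorDual R σ).X m).ρ k), map_zero, ρ_e20, translation_gp]
        simp only [mul_right_inj])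
    (fun hn => descRegularRegular
      (fun x y => if x = y then cornerValue R σ (by lia) x else 0)
      fun k x y => by
        rw [apply_ite (((tensorDual R σ).X m).ρ k), map_zero, ρ_cornerValue]
        simp only [mul_right_inj])

section
variable {n m : ℤ} (hm : n + 1 = m)

lemma contraction_e00 (hn : 0 + 0 = n) :
    (contraction R σ n m hm).hom (e00 R σ hn) = 0 :=
  tensorThreeDesc_t00 (P := oddPair R σ) hn (1 : R) (1 : R)

lemma contraction_e01 (hn : 0 + (-1) = n) (y : G) :
    (contraction R σ n m hm).hom (e01 R σ hn (gp R y)) =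
      e11 R σ (by lia) (gp R y) (gp R y) - e22 R σ (by lia) (gp R y) (gp R (σ * y)) :=
  (tensorThreeDesc_t01 (P := oddPair R σ) hn (1 : R) (gp R y)).trans
    (descUnitRegular_tmul _ _ y)

lemma contraction_e02 (hn : 0 + (-2) = n) (y : G) :
    (contraction R σ n m hm).hom (e02 R σ hn (gp R y)) =
      e12 R σ (by lia) (gp R y) (gp R y) :=
  (tensorThreeDesc_t02 (P := oddPair R σ) hn (1 : R) (gp R y)).trans
    (descUnitRegular_tmul _ _ y)

lemma contraction_e10 (hn : 1 + 0 = n) (x : MonoidAlgebra R G) :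
    (contraction R σ n m hm).hom (e10 R σ hn x) = 0 :=
  tensorThreeDesc_t10 (P := oddPair R σ) hn x (1 : R)

lemma contraction_e11 (hn : 1 + (-1) = n) (x y : G) :
    (contraction R σ n m hm).hom (e11 R σ hn (gp R x) (gp R y)) =
      (if x = σ * y then cornerValue R σ (by lia) x else 0) -
        e21 R σ (by lia) (intervalSum R σ x y) (gp R y) :=
  (tensorThreeDesc_t11 (P := oddPair R σ) hn (gp R x) (gp R y)).trans
    (descRegularRegular_tmul _ _ x y)

lemma contraction_e12 (hn : 1 + (-2) = n) (x y : G) :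
    (contraction R σ n m hm).hom (e12 R σ hn (gp R x) (gp R y)) =
      - e22 R σ (by lia) (intervalSum R σ x y) (gp R y) :=
  (tensorThreeDesc_t12 (P := oddPair R σ) hn (gp R x) (gp R y)).trans
    (descRegularRegular_tmul _ _ x y)

lemma contraction_e20 (hn : 2 + 0 = n) (x : MonoidAlgebra R G) :
    (contraction R σ n m hm).hom (e20 R σ hn x) = 0 :=
  tensorThreeDesc_t20 (P := oddPair R σ) hn x (1 : R)

lemma contraction_e21 (hn : 2 + (-1) = n) (x y : G) :
    (contraction R σ n m hm).hom (e21 R σ hn (gp R x) (gp R y)) =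
      if x = y then e20 R σ (by lia) (gp R x) else 0 :=
  (tensorThreeDesc_t21 (P := oddPair R σ) hn (gp R x) (gp R y)).trans
    (descRegularRegular_tmul _ _ x y)

lemma contraction_e22 (hn : 2 + (-2) = n) (x y : G) :
    (contraction R σ n m hm).hom (e22 R σ hn (gp R x) (gp R y)) =
      if x = y then cornerValue R σ (by lia) x else 0 :=
  (tensorThreeDesc_t22 (P := oddPair R σ) hn (gp R x) (gp R y)).trans
    (descRegularRegular_tmul _ _ x y)

end

/-- The projection to the unit. -/
def unitProjection : (tensorDual R σ).X 0 ⟶ 𝟙_ (Rep.{u} R G) :=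
  tensorThreeDesc (oddPair R σ)
    -- The coefficients `1`, `[x = σ y]` and `[x = y]` are those of `unitElt` in `1 - d H - H d`;
    -- see `homotopy_e00`, `homotopy_e11` and `homotopy_e22`.
    (fun _ => (λ_ _).hom) (fun _ => 0) (fun _ => 0) (fun _ => 0)
    (fun _ => descRegularRegular (W := 𝟙_ (Rep.{u} R G))
      (fun x y => if x = σ * y then (1 : R) else 0)
      fun k x y => by
        change (if x = σ * y then (1 : R) else 0) = _
        simp only [mul_left_comm σ k y, mul_right_inj])
    (fun _ => 0) (fun _ => 0) (fun _ => 0)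
    (fun _ => descRegularRegular (W := 𝟙_ (Rep.{u} R G))
      (fun x y => if x = y then (1 : R) else 0)
      fun k x y => by
        change (if x = y then (1 : R) else 0) = _
        simp only [mul_right_inj])

/-- The projection to the unit as a linear map. -/
def unitProjectionₗ : ((tensorDual R σ).X 0).V →ₗ[R] R := (unitProjection R σ).hom.toLinearMap

lemma unitProjectionₗ_e00 : unitProjectionₗ R σ (e00 R σ rfl) = (1 : R) :=
  (tensorThreeDesc_t00 (P := oddPair R σ) rfl (1 : R) (1 : R)).trans
    (one_smul R (1 : R))

lemma unitProjectionₗ_e11 (x y : G) :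
    unitProjectionₗ R σ (e11 R σ rfl (gp R x) (gp R y)) = if x = σ * y then (1 : R) else 0 :=
  (tensorThreeDesc_t11 (P := oddPair R σ) rfl (gp R x) (gp R y)).trans
    (descRegularRegular_tmul _ _ x y)

lemma unitProjectionₗ_e22 (x y : G) :
    unitProjectionₗ R σ (e22 R σ rfl (gp R x) (gp R y)) = if x = y then (1 : R) else 0 :=
  (tensorThreeDesc_t22 (P := oddPair R σ) rfl (gp R x) (gp R y)).trans
    (descRegularRegular_tmul _ _ x y)

end OddContraction

/-! ### Verification of the homotopy identity for `p > 2`. -/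

section OddHomotopy

variable (R : Type u) [CommRing R] {G : Type} [CommGroup G] [Fintype G] (σ : G)

/-- Rewrite `I(g, h)` through `I(g, σ h)`. After the reindexing `h ↦ σ h` the interval sums cancel,
leaving the added end terms and one norm term from the single `h` with `σ h = g`. -/
lemma sum_e22_intervalSum (hσ : ∀ g : G, g ∈ Subgroup.zpowers σ) {n : ℤ} (hn : 2 + (-2) = n)
    (g : G) :
    ∑ h, e22 R σ hn (intervalSum R σ g h) (gp R (σ * h)) -
      ∑ h, e22 R σ hn (intervalSum R σ g h) (gp R h) =
      e22 R σ hn (normElt R G) (gp R g) - ∑ h, e22 R σ hn (gp R h) (gp R (σ * h)) := by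
  classical
  have h1 (h : G) : e22 R σ hn (intervalSum R σ g h) (gp R (σ * h)) =
      e22 R σ hn (intervalSum R σ g (σ * h)) (gp R (σ * h)) - e22 R σ hn (gp R h) (gp R (σ * h)) +
        if σ * h = g then e22 R σ hn (normElt R G) (gp R g) else 0 := by
    rw [intervalSum_mul_right R hσ]
    split_ifs with h
    · simp only [map_sub, map_add, LinearMap.sub_apply, LinearMap.add_apply, h]
      abel
    · simp only [map_add, LinearMap.add_apply, sub_zero]
      abel
  have h2 : ∑ h, e22 R σ hn (intervalSum R σ g (σ * h)) (gp R (σ * h)) =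
      ∑ h, e22 R σ hn (intervalSum R σ g h) (gp R h) :=
    Equiv.sum_comp (Equiv.mulLeft σ) fun h => e22 R σ hn (intervalSum R σ g h) (gp R h)
  have h3 : ∑ h, (if σ * h = g then e22 R σ hn (normElt R G) (gp R g) else 0) =
      ∑ h, if h = g then e22 R σ hn (normElt R G) (gp R g) else 0 :=
    Equiv.sum_comp (Equiv.mulLeft σ) fun h => if h = g then e22 R σ hn (normElt R G) (gp R g) else 0
  rw [Finset.sum_congr rfl fun h _ => h1 h, Finset.sum_add_distrib, Finset.sum_sub_distrib, h2, h3,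
    Finset.sum_ite_eq' Finset.univ g, if_pos (Finset.mem_univ _)]
  abel

/-- Modulo the unit, this exhibits `e22 N g` as a boundary: the copy of `RG` that survives in
bidegree `(2, -2)`, embedded by the norm in the first factor, is killed by the `RG` of bidegree `(1,
0)`. -/
lemma d_cornerValue (hσ : ∀ g : G, g ∈ Subgroup.zpowers σ) {n m : ℤ} (hm : m = 1) (hn : n = 0)
    (g : G) :
    ((tensorDual R σ).d m n).hom (cornerValue R σ hm g) =
      e22 R σ (by lia) (normElt R G) (gp R g) - unitElt R σ hn := by
  have hN : normElt R G = ∑ h, gp R h := rfl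
  simp only [cornerValue, map_sub, map_sum]
  rw [d_e10 R σ (m := n) (by lia) (by lia) (by lia), augmentationₗ_gp, one_smul]
  simp only [d_e21 R σ (m := n) _ (show 1 + -1 = n by lia) (show 2 + -2 = n by lia),
    Finset.sum_add_distrib, sigmaSubOneₗ_gp, sigmaSubOneₗ_intervalSum R hσ, map_sub,
    LinearMap.sub_apply, Finset.sum_sub_distrib]
  rw [sum_e22_intervalSum R σ hσ, unitElt, ← map_sum, ← hN]
  abel

variable [DecidableEq G]

section
variable {k n m : ℤ} (hm : m + 1 = n) (hk : n + 1 = k)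

lemma homotopy_e02 (hn : 0 + (-2) = n) (y : G) :
    (contraction R σ m n hm).hom (((tensorDual R σ).d n m).hom (e02 R σ hn (gp R y))) +
      ((tensorDual R σ).d k n).hom ((contraction R σ n k hk).hom (e02 R σ hn (gp R y))) =
      e02 R σ hn (gp R y) := by
  rw [d_e02 R σ hn hm, contraction_e02, map_zero, zero_add, d_e12 R σ _ hn, augmentationₗ_gp,
    one_smul]

/-- Telescoping in the first factor gives `e12 x y - e12 y y`; the missing diagonal term comes from
the section on `e02`. -/
lemma homotopy_e12 (hσ : ∀ g : G, g ∈ Subgroup.zpowers σ) (hn : 1 + (-2) = n) (x y : G) :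
    (contraction R σ m n hm).hom (((tensorDual R σ).d n m).hom (e12 R σ hn (gp R x) (gp R y))) +
      ((tensorDual R σ).d k n).hom
        ((contraction R σ n k hk).hom (e12 R σ hn (gp R x) (gp R y))) =
      e12 R σ hn (gp R x) (gp R y) := by
  rw [d_e12 R σ hn (by lia), contraction_e12, augmentationₗ_gp, one_smul, contraction_e02, map_neg,
    d_e22 R σ _ hn, sigmaSubOneₗ_intervalSum R hσ]
  simp only [map_sub, LinearMap.sub_apply]
  abel

/-- Moving the left endpoint recovers `e22 x y` except for `e22 N x` on the diagonal, and
`cornerValue` trades that term for `unitElt`. -/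
lemma homotopy_e22 (hσ : ∀ g : G, g ∈ Subgroup.zpowers σ) (hn : 2 + (-2) = n) (x y : G) :
    (contraction R σ m n hm).hom (((tensorDual R σ).d n m).hom (e22 R σ hn (gp R x) (gp R y))) +
      ((tensorDual R σ).d k n).hom
        ((contraction R σ n k hk).hom (e22 R σ hn (gp R x) (gp R y))) =
      e22 R σ hn (gp R x) (gp R y) - if x = y then unitElt R σ (by lia) else 0 := by
  rw [d_e22 R σ hn (by lia), contraction_e22, sigmaSubOneₗ_gp, map_sub, LinearMap.sub_apply, map_sub,
    contraction_e12, contraction_e12, apply_ite ((tensorDual R σ).d k n).hom,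
    d_cornerValue R σ hσ _ (by lia), map_zero, intervalSum_mul_left R hσ]
  split_ifs with h
  · simp only [map_sub, map_add, LinearMap.sub_apply, LinearMap.add_apply, h]
    abel
  · simp only [map_sub, add_zero, LinearMap.sub_apply]
    abel

lemma homotopy_e01 (hn : 0 + (-1) = n) (y : G) :
    (contraction R σ m n hm).hom (((tensorDual R σ).d n m).hom (e01 R σ hn (gp R y))) +
      ((tensorDual R σ).d k n).hom ((contraction R σ n k hk).hom (e01 R σ hn (gp R y))) =
      e01 R σ hn (gp R y) := by
  rw [d_e01 R σ hn (by lia), contraction_e01, sigmaSubOneₗ_gp, map_sub, map_sub, map_sub,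
    contraction_e02, contraction_e02, d_e11 R σ _ hn (by lia), d_e22 R σ _ (by lia),
    augmentationₗ_gp, one_smul, sigmaSubOneₗ_gp, map_sub, map_sub, LinearMap.sub_apply]
  abel

/-- The diagonal terms and the ordinary interval terms cancel. The wrap-around term `e22 N x`,
present only for `x = σ * y`, is traded for `unitElt` through `cornerValue`. -/
lemma homotopy_e11 (hσ : ∀ g : G, g ∈ Subgroup.zpowers σ) (hn : 1 + (-1) = n) (x y : G) :
    (contraction R σ m n hm).hom (((tensorDual R σ).d n m).hom (e11 R σ hn (gp R x) (gp R y))) +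
      ((tensorDual R σ).d k n).hom
        ((contraction R σ n k hk).hom (e11 R σ hn (gp R x) (gp R y))) =
      e11 R σ hn (gp R x) (gp R y) - if x = σ * y then unitElt R σ (by lia) else 0 := by
  rw [d_e11 R σ hn (by lia) (by lia), contraction_e11, augmentationₗ_gp, one_smul,
    sigmaSubOneₗ_gp, map_sub, map_sub, map_sub, map_sub, contraction_e01, contraction_e12,
    contraction_e12, d_e21 R σ _ hn (by lia), apply_ite ((tensorDual R σ).d k n).hom,
    d_cornerValue R σ hσ _ (by lia), map_zero, intervalSum_mul_right R hσ,
    sigmaSubOneₗ_intervalSum R hσ, sigmaSubOneₗ_gp]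
  simp only [eq_comm (a := x)]
  split_ifs with h
  · simp only [map_sub, map_add, LinearMap.sub_apply, LinearMap.add_apply, h]
    abel
  · simp only [map_sub, map_add, sub_zero, LinearMap.sub_apply, LinearMap.add_apply]
    abel

lemma homotopy_e00 (hn : 0 + 0 = n) :
    (contraction R σ m n hm).hom (((tensorDual R σ).d n m).hom (e00 R σ hn)) +
      ((tensorDual R σ).d k n).hom ((contraction R σ n k hk).hom (e00 R σ hn)) =
      e00 R σ hn - unitElt R σ (by lia) := by
  rw [d_e00 R σ hn (by lia), contraction_e00, map_zero, normElt, map_sum, map_sum]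
  simp only [contraction_e01, Finset.sum_sub_distrib]
  rw [unitElt]
  abel

lemma homotopy_e21 (hσ : ∀ g : G, g ∈ Subgroup.zpowers σ) (hn : 2 + (-1) = n) (x y : G) :
    (contraction R σ m n hm).hom (((tensorDual R σ).d n m).hom (e21 R σ hn (gp R x) (gp R y))) +
      ((tensorDual R σ).d k n).hom
        ((contraction R σ n k hk).hom (e21 R σ hn (gp R x) (gp R y))) =
      e21 R σ hn (gp R x) (gp R y) := by
  -- Passing from `x` to `σ * x` removes `x` from every interval sum and adds `N` at `h = x`. The
  -- three terms on the right are exactly what is missing on the diagonal: the norm term from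
  -- `intervalSum_mul_left`, and the boundary of `e20 x` with opposite sign.
  have hc : cornerValue R σ (m := n) (by lia) (σ * x) - cornerValue R σ (by lia) x =
      e21 R σ hn (normElt R G) (gp R x) - e21 R σ hn (gp R x) (normElt R G) -
      e10 R σ (by lia) (sigmaSubOneₗ R σ (gp R x)) := by
    have hN : normElt R G = ∑ h, gp R h := rfl
    simp only [cornerValue, intervalSum_mul_left R hσ, map_add, map_sub, LinearMap.add_apply,
      LinearMap.sub_apply, sigmaSubOneₗ_gp, Finset.sum_add_distrib, Finset.sum_sub_distrib]
    have h2 : ∑ h, e21 R σ hn (if x = h then normElt R G else 0) (gp R h) =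
        e21 R σ hn (normElt R G) (gp R x) := by
      rw [Finset.sum_eq_single x (fun h _ hh => by rw [if_neg hh.symm, map_zero]; rfl)
        (fun h => absurd (Finset.mem_univ x) h), if_pos rfl]
    rw [h2, ← map_sum, ← hN]
    abel
  rw [d_e21 R σ hn (by lia) (by lia), contraction_e21, sigmaSubOneₗ_gp, sigmaSubOneₗ_gp, map_sub,
    map_sub, LinearMap.sub_apply, map_add, map_sub, map_sub, contraction_e11, contraction_e11,
    contraction_e22, contraction_e22, apply_ite ((tensorDual R σ).d k n).hom,
    d_e20 R σ _ (by lia) hn, map_zero, intervalSum_mul_left R hσ]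
  simp only [mul_right_inj]
  rcases eq_or_ne x y with rfl | h
  · simp only [if_true, map_add, map_sub, LinearMap.add_apply, LinearMap.sub_apply]
    rw [sub_eq_iff_eq_add.1 hc, sigmaSubOneₗ_gp, map_sub]
    abel
  · simp only [if_neg h, add_zero, map_sub, LinearMap.sub_apply]
    abel

/-- Contracting `e11 x N` yields one `cornerValue`, from `h = σ⁻¹ * x`, minus all the interval
terms. The difference is `- e10 x` by the definition of `cornerValue`. -/
lemma homotopy_e10 (hn : 1 + 0 = n) (x : G) :
    (contraction R σ m n hm).hom (((tensorDual R σ).d n m).hom (e10 R σ hn (gp R x))) +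
      ((tensorDual R σ).d k n).hom ((contraction R σ n k hk).hom (e10 R σ hn (gp R x))) =
      e10 R σ hn (gp R x) := by
  rw [d_e10 R σ hn (by lia) (by lia), contraction_e10, map_zero, map_sub, map_smul,
    contraction_e00, normElt, map_sum, map_sum]
  simp only [contraction_e11, Finset.sum_sub_distrib]
  have h2 : ∑ h, (if x = σ * h then cornerValue R σ (m := n) (by lia) x else 0) =
      cornerValue R σ (by lia) x := by
    rw [Finset.sum_eq_single (σ⁻¹ * x) (fun h _ hh => if_neg fun h' => hh (by rw [h']; group))
      (fun h => absurd (Finset.mem_univ _) h), if_pos (by group)]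
  rw [h2, cornerValue]
  simp

lemma homotopy_e20 (hn : 2 + 0 = n) (x : G) :
    (contraction R σ m n hm).hom (((tensorDual R σ).d n m).hom (e20 R σ hn (gp R x))) +
      ((tensorDual R σ).d k n).hom ((contraction R σ n k hk).hom (e20 R σ hn (gp R x))) =
      e20 R σ hn (gp R x) := by
  rw [d_e20 R σ hn (by lia) (by lia), contraction_e20, map_zero, map_add,
    contraction_e10, normElt, map_sum, map_sum]
  simp only [contraction_e21]
  simp

end

lemma unitInclusion_unitProjection (c : Prop) [Decidable c] (v : ((tensorDual R σ).X 0).V)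
    (hv : unitProjectionₗ R σ v = if c then 1 else 0) :
    (unitInclusion R σ).hom ((unitProjection R σ).hom v) = if c then unitElt R σ rfl else 0 := by
  change (unitInclusion R σ).hom (unitProjectionₗ R σ v) = _
  rw [hv]
  split_ifs
  · exact unitInclusion_one R σ
  · exact map_zero _

lemma contraction_degree_zero (hσ : ∀ g : G, g ∈ Subgroup.zpowers σ) :
    (tensorDual R σ).d 0 (-1) ≫ contraction R σ (-1) 0 rfl +
      contraction R σ 0 1 rfl ≫ (tensorDual R σ).d 1 0 +
      unitProjection R σ ≫ unitInclusion R σ = 𝟙 _ := by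
  have key (v : ((tensorDual R σ).X 0).V) : ((tensorDual R σ).d 0 (-1) ≫ contraction R σ (-1) 0 rfl +
      contraction R σ 0 1 rfl ≫ (tensorDual R σ).d 1 0 +
      unitProjection R σ ≫ unitInclusion R σ).hom v =
      (contraction R σ (-1) 0 rfl).hom (((tensorDual R σ).d 0 (-1)).hom v) +
      ((tensorDual R σ).d 1 0).hom ((contraction R σ 0 1 rfl).hom v) +
      (unitInclusion R σ).hom ((unitProjection R σ).hom v) := rfl
  have key' (v : ((tensorDual R σ).X 0).V) : (𝟙 ((tensorDual R σ).X 0) : _).hom v = v := rfl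
  refine tensorDual_hom_ext (fun h => ?_) (fun h y => by lia) (fun h y => by lia)
      (fun h x => by lia) (fun h x y => ?_)
      (fun h x y => by lia) (fun h x => by lia) (fun h x y => by lia) (fun h x y => ?_)
  -- The condition `True` records that `e00` has coefficient one unconditionally.
  · rw [key, key', homotopy_e00 R σ (m := -1) (n := 0) (k := 1) rfl rfl h, unitInclusion_unitProjection R σ True _
      ((unitProjectionₗ_e00 R σ).trans (if_pos trivial).symm), if_pos trivial, sub_add_cancel]
  · rw [key, key', homotopy_e11 R σ (m := -1) (n := 0) (k := 1) rfl rfl hσ h, unitInclusion_unitProjection R σ _ _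
      (unitProjectionₗ_e11 R σ x y), sub_add_cancel]
  · rw [key, key', homotopy_e22 R σ (m := -1) (n := 0) (k := 1) rfl rfl hσ h, unitInclusion_unitProjection R σ _ _
      (unitProjectionₗ_e22 R σ x y), sub_add_cancel]

lemma homotopyEquiv_of_odd [Nontrivial G] (hσ : ∀ g : G, g ∈ Subgroup.zpowers σ) :
    Nonempty (HomotopyEquiv (𝟙_ (Ch R G)) (tensorDual R σ)) := by
  -- With this, `g = σ * g` never holds, so the projection kills both correction sums in `unitElt`
  -- and the inclusion followed by the projection is the identity.
  have hσ1 : σ ≠ 1 := by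
    rintro rfl
    obtain ⟨g, hg⟩ := exists_ne (1 : G)
    exact hg (by simpa using hσ g)
  refine ⟨homotopyEquivSingle (tensorDual R σ) (unitInclusion R σ) ?_ (unitProjection R σ) ?_ ?_
    (contraction R σ) ?_ fun n hn => ?_⟩
  · refine unit_hom_ext R ?_
    change ((tensorDual R σ).d 0 (-1)).hom ((unitInclusion R σ).hom (1 : R)) = 0
    rw [unitInclusion_one, unitElt, map_add, map_sub, map_sum, map_sum]
    simp only [d_e11 R σ (m := -1) _ (show 0 + -1 = -1 by lia) (show 1 + -2 = -1 by lia),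
      d_e22 R σ (m := -1) _ (show 1 + -2 = -1 by lia), augmentationₗ_gp, one_smul, sigmaSubOneₗ_gp,
      map_sub, LinearMap.sub_apply, Finset.sum_sub_distrib]
    -- Reindexing by `σ` cancels the two diagonal sums that the boundaries of the `e11` and `e22`
    -- parts of `unitElt` produce.
    have h : ∑ h, e12 R σ (show 1 + -2 = -1 by lia) (gp R (σ * h)) (gp R (σ * h)) =
        ∑ h, e12 R σ (show 1 + -2 = -1 by lia) (gp R h) (gp R h) :=
      Equiv.sum_comp (Equiv.mulLeft σ) fun h => e12 R σ _ (gp R h) (gp R h)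
    rw [d_e00 R σ (m := -1) _ (by lia), h, normElt, map_sum]
    abel
  · refine tensorDual_hom_ext (fun h => by lia) (fun h y => by lia) (fun h y => by lia)
      (fun h x => ?_) (fun h x y => by lia)
      (fun h x y => by lia) (fun h x => by lia) (fun h x y => ?_) (fun h x y => by lia)
    · change unitProjectionₗ R σ (((tensorDual R σ).d 1 0).hom (e10 R σ h (gp R x))) = 0
      rw [d_e10 R σ (m := 0) _ rfl rfl, augmentationₗ_gp, one_smul, map_sub, unitProjectionₗ_e00,
        normElt, map_sum, map_sum, Finset.sum_congr rfl fun g _ => unitProjectionₗ_e11 R σ x g]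
      rw [Finset.sum_eq_single (σ⁻¹ * x) (fun h _ hh => if_neg fun h' => hh (by rw [h']; group))
        (fun h => absurd (Finset.mem_univ _) h), if_pos (by group), sub_self]
    · change unitProjectionₗ R σ
        (((tensorDual R σ).d 1 0).hom (e21 R σ h (gp R x) (gp R y))) = 0
      rw [d_e21 R σ (m := 0) _ rfl rfl, sigmaSubOneₗ_gp, sigmaSubOneₗ_gp, map_sub, map_sub,
        LinearMap.sub_apply, map_add, map_sub, map_sub, unitProjectionₗ_e11, unitProjectionₗ_e11,
        unitProjectionₗ_e22, unitProjectionₗ_e22]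
      simp only [mul_right_inj]
      abel
  · refine unit_hom_ext R ?_
    change unitProjectionₗ R σ ((unitInclusion R σ).hom (1 : R)) = 1
    rw [unitInclusion_one, unitElt, map_add, map_sub, map_sum, map_sum, unitProjectionₗ_e00,
      Finset.sum_eq_zero fun g _ => (unitProjectionₗ_e11 R σ g g).trans (if_neg fun h => hσ1 ?_),
      Finset.sum_eq_zero fun g _ => (unitProjectionₗ_e22 R σ g (σ * g)).trans
        (if_neg fun h => hσ1 ?_), sub_zero, add_zero]
    · simpa using h.symm
    · simpa using h.symm
  · exact contraction_degree_zero R σ hσ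
  · refine tensorDual_hom_ext (fun h => (hn (by lia)).elim)
      (fun h y => homotopy_e01 R σ _ _ h y) (fun h y => homotopy_e02 R σ _ _ h y)
      (fun h x => homotopy_e10 R σ _ _ h x) (fun h x y => (hn (by lia)).elim)
      (fun h x y => homotopy_e12 R σ _ _ hσ h x y) (fun h x => homotopy_e20 R σ _ _ h x)
      (fun h x y => homotopy_e21 R σ _ _ hσ h x y) (fun h x y => (hn (by lia)).elim)

end OddHomotopy

/-! ### The contraction for a group of order two. -/

section Two

lemma univ_eq_pair {X : Type*} [Fintype X] [DecidableEq X] (hX : Fintype.card X = 2) {x y : X}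
    (h : x ≠ y) : (Finset.univ : Finset X) = {x, y} :=
  (Finset.eq_univ_of_card _ ((Finset.card_pair h).trans hX.symm)).symm

variable (R : Type u) [CommRing R] (G : Type) [CommGroup G] [Fintype G]

/-- The complexes `0 → RG → R → 0` and `0 → R → RG → 0`. -/
abbrev twoPair : ThreeTermPair (0 : Rep.{u} R G) (Rep.leftRegular R G)
    (𝟙_ _) (𝟙_ _) (Rep.leftRegular R G) (0 : Rep.{u} R G) where
  f := 0
  g := augmentation R G
  w := zero_comp
  f' := coaugmentation R G
  g' := 0
  w' := comp_zero

/-- The tensor product of `0 → RG → R → 0` with `0 → R → RG → 0`. -/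
abbrev tensorDualTwo : Ch R G := tensorThree (twoPair R G)

lemma twoPair_f'_one : (twoPair R G).f'.hom (1 : R) = normElt R G := coaugmentation_one R

/-- Elements of bidegree `(0, 0)`. -/
def c00 {n : ℤ} (hn : 0 + 0 = n) :
    ((tensorDualTwo R G).X n).V :=
  t00 (twoPair R G) hn (1 : R) (1 : R)

variable {G} in
lemma ρ_c00 {n : ℤ} (hn : 0 + 0 = n) (k : G) :
    ((tensorDualTwo R G).X n).ρ k (c00 R G hn) =
      c00 R G hn :=
  ρ_t00 (P := twoPair R G) hn k (1 : R) (1 : R)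

/-- Elements of bidegree `(0, -1)`. -/
def c01 {n : ℤ} (hn : 0 + (-1) = n) :
    MonoidAlgebra R G →ₗ[R] ((tensorDualTwo R G).X n).V :=
  t01 (twoPair R G) hn (1 : R)

/-- Elements of bidegree `(1, 0)`. -/
def c10 {n : ℤ} (hn : 1 + 0 = n) :
    MonoidAlgebra R G →ₗ[R] ((tensorDualTwo R G).X n).V :=
  LinearMap.flip (t10 (twoPair R G) hn) (1 : R)

variable {G} in
lemma ρ_c10 {n : ℤ} (hn : 1 + 0 = n) (k : G) (x : MonoidAlgebra R G) :
    ((tensorDualTwo R G).X n).ρ k (c10 R G hn x) =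
      c10 R G hn (translation R k x) :=
  ρ_t10 (P := twoPair R G) hn k x (1 : R)

/-- Elements of bidegree `(1, -1)`. -/
def c11 {n : ℤ} (hn : 1 + (-1) = n) :
    MonoidAlgebra R G →ₗ[R] MonoidAlgebra R G →ₗ[R] ((tensorDualTwo R G).X n).V :=
  t11 (twoPair R G) hn

variable {G} in
lemma ρ_c11 {n : ℤ} (hn : 1 + (-1) = n) (k : G) (x : MonoidAlgebra R G) (y : MonoidAlgebra R G) :
    ((tensorDualTwo R G).X n).ρ k (c11 R G hn x y) =
      c11 R G hn (translation R k x) (translation R k y) :=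
  ρ_t11 (P := twoPair R G) hn k x y

variable {G}

lemma d_c00 {n m : ℤ} (hn : 0 + 0 = n) (h₂ : 0 + (-1) = m) :
    ((tensorDualTwo R G).d n m).hom (c00 R G hn) = c01 R G h₂ (normElt R G) := by
  have key := d_t00 (P := twoPair R G) hn h₂ (1 : R) (1 : R)
  rw [twoPair_f'_one] at key
  exact key

lemma d_c01 {n m : ℤ} (hn : 0 + (-1) = n) (hm : m + 1 = n) (y : MonoidAlgebra R G) :
    ((tensorDualTwo R G).d n m).hom (c01 R G hn y) = 0 :=
  (d_t01 (P := twoPair R G) hn (by lia) (1 : R) y).trans (map_zero _)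

lemma d_c10 {n m : ℤ} (hn : 1 + 0 = n) (h₁ : 0 + 0 = m) (h₂ : 1 + (-1) = m) (x : MonoidAlgebra R G) :
    ((tensorDualTwo R G).d n m).hom (c10 R G hn x) =
      augmentationₗ R G x • c00 R G h₁ - c11 R G h₂ x (normElt R G) := by
  have key := d_t10 (P := twoPair R G) hn h₁ h₂ x (1 : R)
  rw [twoPair_f'_one] at key
  have e := eq_smul_of_unit (t00 (twoPair R G) h₁)
    (1 : R) (augmentationₗ R G x)
  exact key.trans (congrArg (· - _) e)

lemma d_c11 {n m : ℤ} (hn : 1 + (-1) = n) (h₁ : 0 + (-1) = m) (x y : MonoidAlgebra R G) :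
    ((tensorDualTwo R G).d n m).hom (c11 R G hn x y) = augmentationₗ R G x • c01 R G h₁ y := by
  have key := d_t11 (P := twoPair R G) hn h₁ (by lia) x y
  have e := eq_smul_of_unit (t01 (twoPair R G) h₁)
    y (augmentationₗ R G x)
  refine key.trans ((congrArg₂ (· - ·) e ?_).trans (sub_zero _))
  exact map_zero _

variable {R} in
lemma tensorDualTwo_hom_ext {n : ℤ} {W : Rep.{u} R G} {a b : (tensorDualTwo R G).X n ⟶ W}
    (h00 : ∀ (hn : 0 + 0 = n), a.hom (c00 R G hn) = b.hom (c00 R G hn))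
    (h01 : ∀ (hn : 0 + (-1) = n) (y : G), a.hom (c01 R G hn (gp R y)) = b.hom (c01 R G hn (gp R y)))
    (h10 : ∀ (hn : 1 + 0 = n) (x : G), a.hom (c10 R G hn (gp R x)) = b.hom (c10 R G hn (gp R x)))
    (h11 : ∀ (hn : 1 + (-1) = n) (x : G) (y : G), a.hom (c11 R G hn (gp R x) (gp R y)) = b.hom (c11 R G hn (gp R x) (gp R y))) :
    a = b := by
  have h0 (x : (0 : Rep.{u} R G).V) : x = 0 :=
    ((Rep.isZero_iff R G _).1 (isZero_zero _)).elim _ _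
  refine tensorThree_hom_ext (P := twoPair R G)
    (fun hn => eq_on_bilinear (t00 (twoPair R G) hn)
      (PermBasis.unit R G).basis (PermBasis.unit R G).basis fun x y => ?_)
    (fun hn => eq_on_bilinear (t01 (twoPair R G) hn)
      (PermBasis.unit R G).basis (PermBasis.regular R G).basis fun x y => ?_)
    (fun hn x y => by rw [h0 y]; simp only [map_zero])
    (fun hn => eq_on_bilinear (t10 (twoPair R G) hn)
      (PermBasis.regular R G).basis (PermBasis.unit R G).basis fun x y => ?_)
    (fun hn => eq_on_bilinear (t11 (twoPair R G) hn)
      (PermBasis.regular R G).basis (PermBasis.regular R G).basis fun x y => ?_)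
    (fun hn x y => by rw [h0 y]; simp only [map_zero])
    (fun hn x y => by rw [h0 x]; simp only [map_zero, LinearMap.zero_apply])
    (fun hn x y => by rw [h0 x]; simp only [map_zero, LinearMap.zero_apply])
    (fun hn x y => by rw [h0 x]; simp only [map_zero, LinearMap.zero_apply])
  · rw [basis_unit]
    exact h00 hn
  · rw [basis_unit]
    exact h01 hn y
  · rw [basis_unit]
    exact h10 hn x
  · exact h11 hn x y

/-- The generator of the unit in the degree `0` part of the tensor product. -/
def unitEltTwo {m : ℤ} (hm : m = 0) : ((tensorDualTwo R G).X m).V :=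
  -- Again this is the generator minus the contraction of its boundary `c01 N`; there is no `(2,
  -- -2)` part to correct.
  c00 R G (by lia) - ∑ g, c11 R G (by lia) (gp R g) (gp R g)

lemma ρ_unitEltTwo {m : ℤ} (hm : m = 0) (k : G) :
    ((tensorDualTwo R G).X m).ρ k (unitEltTwo R hm) = unitEltTwo R hm := by
  simp only [unitEltTwo, map_sub, map_sum, ρ_c00, ρ_c11, translation_gp]
  congr 1
  exact Fintype.sum_equiv (Equiv.mulLeft k) _ _ fun _ => rfl

variable (G) in
/-- The inclusion of the unit. -/
def unitInclusionTwo : 𝟙_ (Rep.{u} R G) ⟶ (tensorDualTwo R G).X 0 :=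
  (PermBasis.unit R G).desc (fun _ => unitEltTwo R rfl) fun k _ => (ρ_unitEltTwo R rfl k).symm

lemma unitInclusionTwo_one : (unitInclusionTwo R G).hom (1 : R) = unitEltTwo R rfl := by
  have h := (PermBasis.unit R G).desc_basis (W := (tensorDualTwo R G).X 0)
    (fun _ => unitEltTwo R rfl) (fun k _ => (ρ_unitEltTwo R rfl k).symm) PUnit.unit
  rw [basis_unit] at h
  exact h

variable [DecidableEq G]

variable (G) in
/-- The contraction of the tensor product onto its unit. -/
def contractionTwo (n m : ℤ) (hm : n + 1 = m) :
    (tensorDualTwo R G).X n ⟶ (tensorDualTwo R G).X m :=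
  tensorThreeDesc (twoPair R G)
    (fun _ => 0)
    (fun hn => descUnitRegular (fun y => c11 R G (by lia) (gp R y) (gp R y))
      fun k y => by rw [ρ_c11, translation_gp])
    (fun _ => 0) (fun _ => 0)
    -- The diagonal of `RG ⊗ RG` is already matched with bidegree `(0, -1)`. For a group of order
    -- two the off-diagonal part is a single copy of `RG`, and it is cancelled against bidegree `(1,
    -- 0)`.
    (fun hn => descRegularRegular
      (fun x y => if x = y then 0 else - c10 R G (by lia) (gp R x))
      fun k x y => by
        rw [apply_ite (((tensorDualTwo R G).X m).ρ k), map_zero, map_neg, ρ_c10, translation_gp]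
        simp only [mul_right_inj])
    (fun _ => 0) (fun _ => 0) (fun _ => 0) (fun _ => 0)

variable (G) in
/-- The projection to the unit. -/
def unitProjectionTwo : (tensorDualTwo R G).X 0 ⟶ 𝟙_ (Rep.{u} R G) :=
  tensorThreeDesc (twoPair R G)
    (fun _ => (λ_ _).hom) (fun _ => 0) (fun _ => 0) (fun _ => 0)
    (fun _ => descRegularRegular (W := 𝟙_ (Rep.{u} R G))
      (fun x y => if x = y then (0 : R) else 1)
      fun k x y => by
        change (if x = y then (0 : R) else 1) = _
        simp only [mul_right_inj])
    (fun _ => 0) (fun _ => 0) (fun _ => 0) (fun _ => 0)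

variable (G) in
/-- The projection to the unit as a linear map. -/
def unitProjectionTwoₗ : ((tensorDualTwo R G).X 0).V →ₗ[R] R :=
  (unitProjectionTwo R G).hom.toLinearMap

lemma unitProjectionTwoₗ_c00 : unitProjectionTwoₗ R G (c00 R G rfl) = (1 : R) :=
  (tensorThreeDesc_t00 (P := twoPair R G) rfl (1 : R) (1 : R)).trans (one_smul R (1 : R))

lemma unitProjectionTwoₗ_c11 (x y : G) :
    unitProjectionTwoₗ R G (c11 R G rfl (gp R x) (gp R y)) = if x = y then (0 : R) else 1 :=
  (tensorThreeDesc_t11 (P := twoPair R G) rfl (gp R x) (gp R y)).trans (descRegularRegular_tmul _ _ x y)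

section
variable {n m : ℤ} (hm : n + 1 = m)

lemma contractionTwo_c00 (hn : 0 + 0 = n) :
    (contractionTwo R G n m hm).hom (c00 R G hn) = 0 :=
  tensorThreeDesc_t00 (P := twoPair R G) hn (1 : R) (1 : R)

lemma contractionTwo_c01 (hn : 0 + (-1) = n) (y : G) :
    (contractionTwo R G n m hm).hom (c01 R G hn (gp R y)) =
      c11 R G (by lia) (gp R y) (gp R y) :=
  (tensorThreeDesc_t01 (P := twoPair R G) hn (1 : R) (gp R y)).trans
    (descUnitRegular_tmul _ _ y)

lemma contractionTwo_c10 (hn : 1 + 0 = n) (x : MonoidAlgebra R G) :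
    (contractionTwo R G n m hm).hom (c10 R G hn x) = 0 :=
  tensorThreeDesc_t10 (P := twoPair R G) hn x (1 : R)

lemma contractionTwo_c11 (hn : 1 + (-1) = n) (x y : G) :
    (contractionTwo R G n m hm).hom (c11 R G hn (gp R x) (gp R y)) =
      if x = y then 0 else - c10 R G (by lia) (gp R x) :=
  (tensorThreeDesc_t11 (P := twoPair R G) hn (gp R x) (gp R y)).trans
    (descRegularRegular_tmul _ _ x y)

end

section
variable {k n m : ℤ} (hm : m + 1 = n) (hk : n + 1 = k)

lemma homotopyTwo_c01 (hn : 0 + (-1) = n) (y : G) :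
    (contractionTwo R G m n hm).hom (((tensorDualTwo R G).d n m).hom (c01 R G hn (gp R y))) +
      ((tensorDualTwo R G).d k n).hom
        ((contractionTwo R G n k hk).hom (c01 R G hn (gp R y))) =
      c01 R G hn (gp R y) := by
  rw [d_c01 R hn hm, contractionTwo_c01, map_zero, zero_add, d_c11 R _ hn, augmentationₗ_gp,
    one_smul]

/-- Off the diagonal the two elements exhaust the group, so `N = x + y`. The boundary of `- c10 x`,
together with `c11 y y`, is then `c11 x y` minus `unitEltTwo`. -/
lemma homotopyTwo_c11 (hG : Fintype.card G = 2) (hn : 1 + (-1) = n) (x y : G) :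
    (contractionTwo R G m n hm).hom
        (((tensorDualTwo R G).d n m).hom (c11 R G hn (gp R x) (gp R y))) +
      ((tensorDualTwo R G).d k n).hom
        ((contractionTwo R G n k hk).hom (c11 R G hn (gp R x) (gp R y))) =
      c11 R G hn (gp R x) (gp R y) - if x = y then 0 else unitEltTwo R (by lia) := by
  rw [d_c11 R hn (by lia), contractionTwo_c11, augmentationₗ_gp, one_smul, contractionTwo_c01]
  split_ifs with h
  · rw [map_zero, add_zero, sub_zero, h]
  · have huniv := univ_eq_pair hG h
    rw [map_neg, d_c10 R _ (by lia) (by lia), augmentationₗ_gp, one_smul, unitEltTwo, normElt, huniv,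
      Finset.sum_pair h, Finset.sum_pair h, map_add]
    abel

lemma homotopyTwo_c00 (hn : 0 + 0 = n) :
    (contractionTwo R G m n hm).hom (((tensorDualTwo R G).d n m).hom (c00 R G hn)) +
      ((tensorDualTwo R G).d k n).hom ((contractionTwo R G n k hk).hom (c00 R G hn)) =
      c00 R G hn - unitEltTwo R (by lia) := by
  rw [d_c00 R hn (by lia), contractionTwo_c00, map_zero, normElt, map_sum, map_sum]
  simp only [contractionTwo_c01]
  rw [unitEltTwo]
  abel

lemma homotopyTwo_c10 (hG : Fintype.card G = 2) (hn : 1 + 0 = n) (x : G) :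
    (contractionTwo R G m n hm).hom (((tensorDualTwo R G).d n m).hom (c10 R G hn (gp R x))) +
      ((tensorDualTwo R G).d k n).hom
        ((contractionTwo R G n k hk).hom (c10 R G hn (gp R x))) =
      c10 R G hn (gp R x) := by
  have := Fintype.one_lt_card_iff_nontrivial.1 (hG ▸ one_lt_two)
  obtain ⟨y, hy⟩ := exists_ne x
  rw [d_c10 R hn (by lia) (by lia), contractionTwo_c10, map_zero, map_sub, map_smul,
    contractionTwo_c00, normElt, univ_eq_pair hG hy.symm, Finset.sum_pair hy.symm, map_add, map_add,
    contractionTwo_c11, contractionTwo_c11, if_pos rfl, if_neg hy.symm]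
  simp

end

lemma unitInclusionTwo_unitProjectionTwo (c : Prop) [Decidable c]
    (v : ((tensorDualTwo R G).X 0).V) (hv : unitProjectionTwoₗ R G v = if c then 0 else 1) :
    (unitInclusionTwo R G).hom ((unitProjectionTwo R G).hom v) =
      if c then 0 else unitEltTwo R rfl := by
  change (unitInclusionTwo R G).hom (unitProjectionTwoₗ R G v) = _
  rw [hv]
  split_ifs
  · exact map_zero _
  · exact unitInclusionTwo_one R

lemma contractionTwo_degree_zero (hG : Fintype.card G = 2) :
    (tensorDualTwo R G).d 0 (-1) ≫ contractionTwo R G (-1) 0 rfl +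
      contractionTwo R G 0 1 rfl ≫ (tensorDualTwo R G).d 1 0 +
      unitProjectionTwo R G ≫ unitInclusionTwo R G = 𝟙 _ := by
  have key (v : ((tensorDualTwo R G).X 0).V) :
      ((tensorDualTwo R G).d 0 (-1) ≫ contractionTwo R G (-1) 0 rfl +
      contractionTwo R G 0 1 rfl ≫ (tensorDualTwo R G).d 1 0 +
      unitProjectionTwo R G ≫ unitInclusionTwo R G).hom v =
      (contractionTwo R G (-1) 0 rfl).hom (((tensorDualTwo R G).d 0 (-1)).hom v) +
      ((tensorDualTwo R G).d 1 0).hom ((contractionTwo R G 0 1 rfl).hom v) +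
      (unitInclusionTwo R G).hom ((unitProjectionTwo R G).hom v) := rfl
  have key' (v : ((tensorDualTwo R G).X 0).V) : (𝟙 ((tensorDualTwo R G).X 0) : _).hom v = v := rfl
  refine tensorDualTwo_hom_ext (fun h => ?_) (fun h y => by lia)
      (fun h x => by lia) (fun h x y => ?_)
  · rw [key, key', homotopyTwo_c00 R (m := -1) (n := 0) (k := 1) rfl rfl h,
      unitInclusionTwo_unitProjectionTwo R False _
      ((unitProjectionTwoₗ_c00 R).trans (if_neg not_false).symm), if_neg not_false, sub_add_cancel]
  · rw [key, key', homotopyTwo_c11 R (m := -1) (n := 0) (k := 1) rfl rfl hG h,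
      unitInclusionTwo_unitProjectionTwo R _ _ (unitProjectionTwoₗ_c11 R x y), sub_add_cancel]

lemma homotopyEquiv_of_two (hG : Fintype.card G = 2) :
    Nonempty (HomotopyEquiv (𝟙_ (Ch R G)) (tensorDualTwo R G)) := by
  have := Fintype.one_lt_card_iff_nontrivial.1 (hG ▸ one_lt_two)
  refine ⟨homotopyEquivSingle (tensorDualTwo R G) (unitInclusionTwo R G) ?_
    (unitProjectionTwo R G) ?_ ?_ (contractionTwo R G) (contractionTwo_degree_zero R hG)
    fun n hn => ?_⟩
  · refine unit_hom_ext R ?_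
    change ((tensorDualTwo R G).d 0 (-1)).hom ((unitInclusionTwo R G).hom (1 : R)) = 0
    rw [unitInclusionTwo_one, unitEltTwo, map_sub, map_sum, d_c00 R (m := -1) _ (by lia), normElt,
      map_sum]
    simp only [d_c11 R (m := -1) _ (show 0 + -1 = -1 by lia), augmentationₗ_gp, one_smul, sub_self]
  · refine tensorDualTwo_hom_ext (fun h => by lia) (fun h y => by lia) (fun h x => ?_)
      (fun h x y => by lia)
    change unitProjectionTwoₗ R G (((tensorDualTwo R G).d 1 0).hom (c10 R G h (gp R x))) = 0
    obtain ⟨y, hy⟩ := exists_ne x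
    rw [d_c10 R (m := 0) _ rfl rfl, augmentationₗ_gp, one_smul, map_sub, unitProjectionTwoₗ_c00,
      normElt, univ_eq_pair hG hy.symm, Finset.sum_pair hy.symm, map_add, map_add,
      unitProjectionTwoₗ_c11, unitProjectionTwoₗ_c11, if_pos rfl, if_neg hy.symm, zero_add, sub_self]
  · refine unit_hom_ext R ?_
    change unitProjectionTwoₗ R G ((unitInclusionTwo R G).hom (1 : R)) = 1
    rw [unitInclusionTwo_one, unitEltTwo, map_sub, map_sum, unitProjectionTwoₗ_c00,
      Finset.sum_eq_zero fun g _ => (unitProjectionTwoₗ_c11 R g g).trans (if_pos rfl), sub_zero]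
  · exact tensorDualTwo_hom_ext (fun h => (hn (by lia)).elim)
      (fun h y => homotopyTwo_c01 R _ _ h y) (fun h x => homotopyTwo_c10 R _ _ hG h x)
      (fun h x y => (hn (by lia)).elim)

end Two

/-! ### From the homotopy equivalence to invertibility in the idempotent completion. -/

section Invertibility

open Idempotents

/-- The tensor product of two objects is unit in the idempotent completion if it is so in the
category itself. -/
lemma nonempty_karoubi_tensor_iso_unit {C : Type*} [Category C] [MonoidalCategory C] {X Y : C}
    (e : X ⊗ Y ≅ 𝟙_ C) :
    Nonempty ((toKaroubi C).obj X ⊗ (toKaroubi C).obj Y ≅ 𝟙_ (Karoubi C)) := by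
  -- The tensor product of the two images carries the idempotent `𝟙 X ⊗ₘ 𝟙 Y`, which is not
  -- literally an identity and has to be absorbed in each field.
  refine ⟨{ hom := ⟨e.hom, ?_⟩, inv := ⟨e.inv, ?_⟩, hom_inv_id := ?_, inv_hom_id := ?_ }⟩
  · change (𝟙 X ⊗ₘ 𝟙 Y) ≫ e.hom ≫ 𝟙 _ = e.hom
    simp
  · change 𝟙 _ ≫ e.inv ≫ (𝟙 X ⊗ₘ 𝟙 Y) = e.inv
    simp
  · ext
    change e.hom ≫ e.inv = 𝟙 X ⊗ₘ 𝟙 Y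
    simp
  · ext
    exact e.inv_hom_id

variable {R : Type u} [CommRing R] {G : Type} [Group G]

lemma isTensorInvertible_of {K L : Ch R G} (hK : IsBoundedPerm K) (hL : IsBoundedPerm L)
    (e : HomotopyEquiv (𝟙_ (Ch R G)) (K ⊗ L)) :
    IsTensorInvertible (SmallPermCat.of K hK) := by
  let X : Kb R G := ⟨(HomotopyCategory.quotient _ _).obj K, hK⟩
  let Y : Kb R G := ⟨(HomotopyCategory.quotient _ _).obj L, hL⟩
  have i : X ⊗ Y ≅ 𝟙_ (Kb R G) :=
    (boundedPerm R G).isoMk (HomotopyCategory.isoOfHomotopyEquiv e).symm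
  exact ⟨(toKaroubi _).obj Y, nonempty_karoubi_tensor_iso_unit i⟩

theorem isTensorInvertible_uObj {p : ℕ} (hp : p.Prime) {G : Type} [CommGroup G] [Finite G]
    (hG : Nat.card G = p) (σ : G) (hσ : ∀ g : G, g ∈ Subgroup.zpowers σ) :
    IsTensorInvertible (uObj R σ p) := by
  classical
  have := Fintype.ofFinite G
  rw [Nat.card_eq_fintype_card] at hG
  have hreg : IsPerm (Rep.leftRegular R G : Rep.{u} R G) := isPerm_ofMulAction G
  by_cases h2 : p = 2
  · obtain ⟨e⟩ := homotopyEquiv_of_two R (hG.trans h2)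
    have hu : uComplex R σ p = threeTerm (0 : (0 : Rep.{u} R G) ⟶ Rep.leftRegular R G)
        (augmentation R G) zero_comp := if_pos h2
    refine isTensorInvertible_of (isBoundedPerm_uComplex R σ p)
      (isBoundedPerm_coThreeTerm (coaugmentation R G)
        (0 : Rep.leftRegular R G ⟶ (0 : Rep.{u} R G)) comp_zero isPerm_unit hreg
        (isPerm_zero (isZero_zero _))) ?_
    rw [hu]
    exact e
  · have : Nontrivial G := Fintype.one_lt_card_iff_nontrivial.1 (hG ▸ hp.one_lt)
    obtain ⟨e⟩ := homotopyEquiv_of_odd R σ hσ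
    have hu : uComplex R σ p = threeTerm (sigmaSubOne R σ) (augmentation R G)
        (sigmaSubOne_augmentation R σ) := if_neg h2
    -- Identifying `RG` with its dual by the basis of group elements, the transpose of `ε` is the
    -- norm inclusion and that of `σ - 1` is `σ⁻¹ - 1 = -σ⁻¹ (σ - 1)`. Since `-σ⁻¹` is an
    -- automorphism, `σ - 1` gives an isomorphic complex.
    refine isTensorInvertible_of (isBoundedPerm_uComplex R σ p)
      (isBoundedPerm_coThreeTerm (coaugmentation R G) (sigmaSubOne R σ)
        (coaugmentation_sigmaSubOne R σ) isPerm_unit hreg hreg) ?_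
    rw [hu]
    exact e

end Invertibility

/-! ### Additive functors on three-term complexes. -/

section ThreeTermIso

variable {C D : Type*} [Category C] [Preadditive C] [HasZeroObject C] [Category D] [Preadditive D]
  [HasZeroObject D] {X₂ X₁ X₀ : C} {Y₂ Y₁ Y₀ : D}

/-- The image of a three-term complex under an additive functor. -/
def mapThreeTermIso (F : C ⥤ D) [F.Additive] {f : X₂ ⟶ X₁} {g : X₁ ⟶ X₀} {h : f ≫ g = 0}
    {f' : Y₂ ⟶ Y₁} {g' : Y₁ ⟶ Y₀} {h' : f' ≫ g' = 0}
    (e₂ : F.obj X₂ ≅ Y₂) (e₁ : F.obj X₁ ≅ Y₁) (e₀ : F.obj X₀ ≅ Y₀)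
    (hf : e₂.hom ≫ f' = F.map f ≫ e₁.hom) (hg : e₁.hom ≫ g' = F.map g ≫ e₀.hom) :
    (F.mapHomologicalComplex (ComplexShape.down ℤ)).obj (threeTerm f g h) ≅ threeTerm f' g' h' :=
  HomologicalComplex.Hom.isoOfComponents
    (fun
      | .ofNat 0 => e₀
      | .ofNat 1 => e₁
      | .ofNat 2 => e₂
      | .ofNat (_ + 3) => (F.map_isZero (isZero_zero C)).iso (isZero_zero D)
      | .negSucc _ => (F.map_isZero (isZero_zero C)).iso (isZero_zero D))
    (by
      rintro i j (rfl : j + 1 = i)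
      match j with
      | .ofNat 0 =>
        change e₁.hom ≫ (threeTerm f' g' h').d 1 0 = F.map ((threeTerm f g h).d 1 0) ≫ e₀.hom
        rw [threeTerm_d_one_zero, threeTerm_d_one_zero]
        exact hg
      | .ofNat 1 =>
        change e₂.hom ≫ (threeTerm f' g' h').d 2 1 = F.map ((threeTerm f g h).d 2 1) ≫ e₁.hom
        rw [threeTerm_d_two_one, threeTerm_d_two_one]
        exact hf
      | .ofNat (_ + 2) => exact (F.map_isZero (isZero_zero C)).eq_of_src _ _
      | .negSucc _ => exact (isZero_zero D).eq_of_tgt _ _)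

end ThreeTermIso

/-! ### Base change of permuted bases and of `u`. -/

section BaseChangeIso

variable (R S : Type u) [CommRing R] [CommRing S] [Algebra R S]

namespace PermBasis

variable {R} {G : Type} [Group G] {V W : Rep.{u} R G} {X : Type} [MulAction G X]

lemma hom_ext (b : PermBasis V X) {f g : V ⟶ W}
    (h : ∀ x, f.hom (b.basis x) = g.hom (b.basis x)) : f = g :=
  Rep.hom_ext (Representation.IntertwiningMap.ext (b.basis.ext h))

/-- Representations with the same permuted basis are isomorphic. -/
def iso (b : PermBasis V X) (c : PermBasis W X) : V ≅ W where
  hom := b.desc c.basis fun g x => (c.ρ_basis g x).symm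
  inv := c.desc b.basis fun g x => (b.ρ_basis g x).symm
  hom_inv_id := b.hom_ext fun x => by simp
  inv_hom_id := c.hom_ext fun x => by simp

lemma iso_hom_basis (b : PermBasis V X) (c : PermBasis W X) (x : X) :
    (b.iso c).hom.hom (b.basis x) = c.basis x :=
  b.desc_basis c.basis (fun g x => (c.ρ_basis g x).symm) x

/-- Base change of a permuted basis. -/
def baseChange (b : PermBasis V X) : PermBasis ((baseChangeRep R S G).obj V) X where
  basis := b.basis.baseChange S
  ρ_basis g x := by
    change (V.ρ g).baseChange S (b.basis.baseChange S x) = _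
    rw [Module.Basis.baseChange_apply, LinearMap.baseChange_tmul, b.ρ_basis]
    exact (b.basis.baseChange_apply S (g • x)).symm

lemma baseChange_basis (b : PermBasis V X) (x : X) :
    (b.baseChange S).basis x = (1 : S) ⊗ₜ[R] b.basis x :=
  b.basis.baseChange_apply S x

end PermBasis

variable {G : Type} [CommGroup G] (σ : G)

/-- Base change of the regular representation. -/
def baseChangeRegular :
    (baseChangeRep R S G).obj (Rep.leftRegular R G) ≅ (Rep.leftRegular S G : Rep.{u} S G) :=
  ((PermBasis.regular R G).baseChange S).iso (PermBasis.regular S G)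

variable (G) in
/-- Base change of the trivial representation. -/
def baseChangeUnit : (baseChangeRep R S G).obj (𝟙_ (Rep.{u} R G)) ≅ 𝟙_ (Rep.{u} S G) :=
  ((PermBasis.unit R G).baseChange S).iso (PermBasis.unit S G)

lemma baseChangeRegular_tmul (g : G) :
    (baseChangeRegular R S).hom.hom ((1 : S) ⊗ₜ[R] gp R g) = gp S g := by
  have := ((PermBasis.regular R G).baseChange S).iso_hom_basis (PermBasis.regular S G) g
  rw [PermBasis.baseChange_basis] at this
  exact this

lemma baseChangeUnit_tmul :
    (baseChangeUnit R S G).hom.hom ((1 : S) ⊗ₜ[R] (1 : R)) = (1 : S) := by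
  have := ((PermBasis.unit R G).baseChange S).iso_hom_basis (PermBasis.unit S G) PUnit.unit
  rw [PermBasis.baseChange_basis, basis_unit, basis_unit] at this
  exact this

/-- Both sides send the basis vector of `g` to `σ * g - g`: the formula has integral coefficients
and does not see the ring. -/
lemma baseChangeRegular_sigmaSubOne :
    (baseChangeRegular R S).hom ≫ sigmaSubOne S σ =
      (baseChangeRep R S G).map (sigmaSubOne R σ) ≫ (baseChangeRegular R S).hom := by
  refine ((PermBasis.regular R G).baseChange S).hom_ext fun g => ?_
  rw [PermBasis.baseChange_basis, basis_regular]
  change sigmaSubOneₗ S σ ((baseChangeRegular R S).hom.hom ((1 : S) ⊗ₜ[R] gp R g)) =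
    (baseChangeRegular R S).hom.hom ((1 : S) ⊗ₜ[R] sigmaSubOneₗ R σ (gp R g))
  rw [baseChangeRegular_tmul, sigmaSubOneₗ_gp, sigmaSubOneₗ_gp, TensorProduct.tmul_sub]
  refine Eq.trans ?_ (map_sub (baseChangeRegular R S).hom.hom.toLinearMap _ _).symm
  exact (congrArg₂ (· - ·) (baseChangeRegular_tmul R S (σ * g)) (baseChangeRegular_tmul R S g)).symm

lemma baseChangeRegular_augmentation :
    (baseChangeRegular R S).hom ≫ augmentation S G =
      (baseChangeRep R S G).map (augmentation R G) ≫ (baseChangeUnit R S G).hom := by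
  refine ((PermBasis.regular R G).baseChange S).hom_ext fun g => ?_
  rw [PermBasis.baseChange_basis, basis_regular]
  change augmentationₗ S G ((baseChangeRegular R S).hom.hom ((1 : S) ⊗ₜ[R] gp R g)) =
    (baseChangeUnit R S G).hom.hom ((1 : S) ⊗ₜ[R] augmentationₗ R G (gp R g))
  rw [baseChangeRegular_tmul, augmentationₗ_gp, augmentationₗ_gp]
  exact (baseChangeUnit_tmul R S).symm

/-- Base change of the complexes `u_{p,R}`. -/
def baseChangeUComplex (p : ℕ) :
    ((baseChangeRep R S G).mapHomologicalComplex (ComplexShape.down ℤ)).obj (uComplex R σ p) ≅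
      uComplex S σ p :=
  if h : p = 2 then
    -- The two `eqToIso` resolve the case distinction on `p` in `uComplex`, over `R` before base
    -- change and over `S` after it.
    ((baseChangeRep R S G).mapHomologicalComplex _).mapIso (eqToIso (if_pos h)) ≪≫
      mapThreeTermIso (baseChangeRep R S G)
        (((baseChangeRep R S G).map_isZero (isZero_zero _)).iso (isZero_zero _))
        (baseChangeRegular R S) (baseChangeUnit R S G)
        (((baseChangeRep R S G).map_isZero (isZero_zero _)).eq_of_src _ _)
        (baseChangeRegular_augmentation R S) ≪≫ eqToIso (if_pos h).symm
  else
    ((baseChangeRep R S G).mapHomologicalComplex _).mapIso (eqToIso (if_neg h)) ≪≫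
      mapThreeTermIso (baseChangeRep R S G) (baseChangeRegular R S)
        (baseChangeRegular R S) (baseChangeUnit R S G)
        (baseChangeRegular_sigmaSubOne R S σ)
        (baseChangeRegular_augmentation R S) ≪≫ eqToIso (if_neg h).symm

theorem nonempty_baseChange_uObj_iso [Finite G] (p : ℕ) :
    Nonempty ((baseChange R S G).obj (uObj R σ p) ≅ uObj S σ p) := by
  let X : Kb R G := ⟨(HomotopyCategory.quotient _ _).obj (uComplex R σ p),
    isBoundedPerm_uComplex R σ p⟩
  let Y : Kb S G := ⟨(HomotopyCategory.quotient _ _).obj (uComplex S σ p),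
    isBoundedPerm_uComplex S σ p⟩
  have e : (baseChangeKb R S G).obj X ≅ Y :=
    (boundedPerm S G).isoMk ((HomotopyCategory.quotient _ _).mapIso (baseChangeUComplex R S σ p))
  -- The extension of a functor to idempotent completions agrees with the functor itself on objects
  -- coming from `toKaroubi`, which reduces the claim to an isomorphism of complexes.
  exact ⟨((Idempotents.functorExtension₂CompWhiskeringLeftToKaroubiIso _ _).app
    (baseChangeKb R S G)).app X ≪≫ (Idempotents.toKaroubi (Kb S G)).mapIso e⟩

end BaseChangeIso
end
end PermutationModules

theorem mainTheorem12 {p : ℕ} (hp : p.Prime) {G : Type} [CommGroup G] [Finite G]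
    (hG : Nat.card G = p) (σ : G) (hσ : ∀ g : G, g ∈ Subgroup.zpowers σ)
    {R : Type u} [CommRing R] [IsNoetherianRing R] :
    PermutationModules.IsTensorInvertible (PermutationModules.uObj R σ p) ∧
    ∀ 𝔭 : PrimeSpectrum R,
      Nonempty ((PermutationModules.baseChange R 𝔭.asIdeal.ResidueField G).obj
          (PermutationModules.uObj R σ p) ≅
        PermutationModules.uObj 𝔭.asIdeal.ResidueField σ p) :=
  ⟨PermutationModules.isTensorInvertible_uObj hp hG σ hσ,
    fun _ => PermutationModules.nonempty_baseChange_uObj_iso R _ σ p⟩
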